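/- Let $\mathbb{R}_{\max}=\mathbb{R}\cup\{-\infty\}$ be the max-plus semiring, and let $\mathcal{C}\subset\mathbb{R}_{\max}^n$ be a real polyhedral cone, i.e. the set of all tropical linear combinations $\max_{1\le r\le p}(\lambda_r+v^r)$, $\lambda_r\in\mathbb{R}_{\max}$, of finitely many vectors $v^1,\dots,v^p\in\mathbb{R}^n$, $p\ge 1$; it is identified with its image in $\mathbb{P}^{n-1}=\mathbb{R}^n/\mathbb{R}(1,\dots,1)$, endowed with the topology of the Hilbert metric $d_H(x,y)=\max_i(x_i-y_i)-\min_i(x_i-y_i)$. For $a\in\mathbb{R}^n$ and a non-empty proper subset $I$ of $[n]=\{1,\dots,n\}$, let $$\mathcal{H}(a,I)=\{x\in\mathbb{R}_{\max}^n : \max_{i\in I}(x_i-a_i)\ge\max_{j\notin I}(x_j-a_j)\}$$ be the (non-degenerate) half-space with apex $a\in\mathbb{P}^{n-1}$. More generally, a possibly degenerate half-space is a set $\{x : \max_{i\in I}(x_i-a_i)\ge\max_{j\in J}(x_j-a_j)\}$ with $I,J$ non-empty disjoint subsets of $[n]$; a half-space is minimal with respect to $\mathcal{C}$ if it is minimal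 for inclusion among the possibly degenerate half-spaces containing $\mathcal{C}$. Let $\Sigma$ be the set of non-degenerate half-spaces containing $\mathcal{C}$ whose apex belongs to $\mathcal{C}$, and for $\Gamma\subset\Sigma$ let $\tau(\Gamma)$ be the set of all $\mathcal{H}\in\Sigma$ containing $\bigcap_{\mathcal{H}'\in\Gamma}\mathcal{H}'$. A non-redundant external representation of $\mathcal{C}$ is a finite set $\Gamma\subset\Sigma$ such that $\mathcal{C}=\bigcap_{\mathcal{H}\in\Gamma}\mathcal{H}$ and $\mathcal{H}\notin\tau(\Gamma\setminus\{\mathcal{H}\})$ for every $\mathcal{H}\in\Gamma$. For $a\in\mathbb{P}^{n-1}$ let $\Sigma_a$ be the set of non-degenerate half-spaces with apex $a$ containing $\mathcal{C}$, and for a subset $X$ of the boundary $\partial\mathcal{C}$ (in $\mathbb{P}^{n-1}$) let $\tau'(X)=\{a\in\partial\mathcal{C} : \Sigma_a\subset\tau(\bigcup_{b\in X}\Sigma_b)\}$. The set $\mathcal{A}$ of non-redundant apices of $\mathcal{C}$ is the unique minimal (for inclusion) finite subset of $\partial\mathcal{C}$ with $\tau'(\mathcal{A})=\partial\mathcal{C}$.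 Suppose that $\mathcal{C}$ is pure, i.e. equal, in $\mathbb{P}^{n-1}$, to the closure of its interior. Then the set $\mathcal{A}$ is well defined (there is exactly one such minimal finite set), every non-redundant external representation of $\mathcal{C}$ consists of precisely one half-space $\mathcal{H}(a,I)$ for each non-redundant apex $a\in\mathcal{A}$, and there exists a unique non-redundant external representation of $\mathcal{C}$ composed of half-spaces that are minimal with respect to $\mathcal{C}$. -/

import Mathlib

/-!
Conventions: the max-plus semiring is `WithBot ℝ`, with tropical addition `⊔` and tropical
multiplication `+`; the index set `[n]` is `Fin n`. Cones and half-spaces are subsets of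
`Fin n → WithBot ℝ`, stable under tropical scalar multiplication. Points (apices) are classes in the
projective space `ProjSpace n`.
-/

namespace TropicalCone

/-- The real projective space `ℝⁿ / ℝ(1,…,1)`. Its (quotient) topology is the one of the tropical
projective Hilbert metric `d_H(x,y) = max (xᵢ - yᵢ) - min (xᵢ - yᵢ)`: the quotient of the sup norm
is `½ d_H`. -/
abbrev ProjSpace (n : ℕ) : Type :=
  (Fin n → ℝ) ⧸ Submodule.span ℝ {(1 : Fin n → ℝ)}

/-- The class of a real vector in the projective space. -/
def toProj {n : ℕ} (x : Fin n → ℝ) : ProjSpace n :=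
  Submodule.Quotient.mk x

/-- The inclusion of `ℝⁿ` into max-plus vectors. -/
def ofReal {n : ℕ} (x : Fin n → ℝ) : Fin n → WithBot ℝ :=
  fun i => (x i : WithBot ℝ)

/-- The tropical cone generated by finitely many real vectors `v 1, …, v p`. -/
def generatedCone {n p : ℕ} (v : Fin p → Fin n → ℝ) : Set (Fin n → WithBot ℝ) :=
  {x | ∃ c : Fin p → WithBot ℝ,
    ∀ i, x i = Finset.univ.sup (fun r => c r + (v r i : WithBot ℝ))}

/-- A real polyhedral cone is a tropical cone generated by a finite nonempty family of
real vectors. -/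
def IsRealPolyhedralCone {n : ℕ} (C : Set (Fin n → WithBot ℝ)) : Prop :=
  ∃ (p : ℕ) (v : Fin p → Fin n → ℝ), 0 < p ∧ C = generatedCone v

/-- The image of a set of max-plus vectors in the real projective space. -/
def projImage {n : ℕ} (C : Set (Fin n → WithBot ℝ)) : Set (ProjSpace n) :=
  toProj '' {x | ofReal x ∈ C}

/-- `C` is pure if it is the closure of its interior (in the projective space). -/
def IsPure {n : ℕ} (C : Set (Fin n → WithBot ℝ)) : Prop :=
  projImage C = closure (interior (projImage C))

/-- The boundary of `C` (in the projective space). -/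
def boundary {n : ℕ} (C : Set (Fin n → WithBot ℝ)) : Set (ProjSpace n) :=
  frontier (projImage C)

/-- The set `{x | max_{i ∈ I} (xᵢ - aᵢ) ≥ max_{j ∈ J} (xⱼ - aⱼ)}`. -/
def halfSpace {n : ℕ} (a : Fin n → ℝ) (I J : Finset (Fin n)) : Set (Fin n → WithBot ℝ) :=
  {x | J.sup (fun j => x j + ((-a j : ℝ) : WithBot ℝ)) ≤
    I.sup (fun i => x i + ((-a i : ℝ) : WithBot ℝ))}

/-- Tropical half-spaces, possibly degenerate. -/
def IsHalfSpace {n : ℕ} (H : Set (Fin n → WithBot ℝ)) : Prop :=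
  ∃ (a : Fin n → ℝ) (I J : Finset (Fin n)),
    I.Nonempty ∧ J.Nonempty ∧ Disjoint I J ∧ H = halfSpace a I J

/-- `H` is a non-degenerate half-space `H(a, I)` whose apex is the class `a`; here `I` is a
nonempty proper subset of `[n]`. -/
def HasApex {n : ℕ} (H : Set (Fin n → WithBot ℝ)) (a : ProjSpace n) : Prop :=
  ∃ (b : Fin n → ℝ) (I : Finset (Fin n)),
    I.Nonempty ∧ I ≠ Finset.univ ∧ toProj b = a ∧ H = halfSpace b I Iᶜ

/-- `H` is minimal for inclusion among the (possibly degenerate) half-spaces containing `C`. -/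
def IsMinimalHalfSpace {n : ℕ} (C H : Set (Fin n → WithBot ℝ)) : Prop :=
  Minimal (fun K => IsHalfSpace K ∧ C ⊆ K) H

/-- The set `Σ` of non-degenerate half-spaces containing `C` with apex in `C`. -/
def sigma {n : ℕ} (C : Set (Fin n → WithBot ℝ)) : Set (Set (Fin n → WithBot ℝ)) :=
  {H | C ⊆ H ∧ ∃ a ∈ projImage C, HasApex H a}

/-- The set `Σ_a` of non-degenerate half-spaces containing `C` with apex `a`. -/
def sigmaAt {n : ℕ} (C : Set (Fin n → WithBot ℝ)) (a : ProjSpace n) :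
    Set (Set (Fin n → WithBot ℝ)) :=
  {H | C ⊆ H ∧ HasApex H a}

/-- `τ(Γ)`: the half-spaces in `Σ` which are redundant with respect to `Γ`. -/
def tau {n : ℕ} (C : Set (Fin n → WithBot ℝ)) (Γ : Set (Set (Fin n → WithBot ℝ))) :
    Set (Set (Fin n → WithBot ℝ)) :=
  {H | H ∈ sigma C ∧ ⋂₀ Γ ⊆ H}

/-- Non-redundant external representations of `C` (by finitely many non-degenerate half-spaces
with apices in `C`). -/
def IsNonRedundantRep {n : ℕ} (C : Set (Fin n → WithBot ℝ))
    (Γ : Set (Set (Fin n → WithBot ℝ))) : Prop :=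
  Γ.Finite ∧ Γ ⊆ sigma C ∧ C = ⋂₀ Γ ∧ ∀ H ∈ Γ, H ∉ tau C (Γ \ {H})

/-- The closure operator `τ'` on the boundary of `C`. -/
def tauApex {n : ℕ} (C : Set (Fin n → WithBot ℝ)) (X : Set (ProjSpace n)) :
    Set (ProjSpace n) :=
  {a | a ∈ boundary C ∧ sigmaAt C a ⊆ tau C (⋃ b ∈ X, sigmaAt C b)}

/-- `A` is a minimal finite spanning set of `∂C` for `τ'`. The unique such `A` is the set of
non-redundant apices of `C`. -/
def IsNonRedundantApexSet {n : ℕ} (C : Set (Fin n → WithBot ℝ)) (A : Set (ProjSpace n)) : Prop :=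
  Minimal (fun X => X.Finite ∧ X ⊆ boundary C ∧ tauApex C X = boundary C) A

end TropicalCone

/-! Around a real point `a`, space is covered by n closed sectors, and `argTop x a` lists those
containing `x`. A point is in the cone iff each sector at it contains a generator; H(a, I) contains
the cone iff each generator lies in a sector of I. Every such I contains `core v a`, the sectors
with a generator in their interior. Purity makes the core itself admissible at every point of the
cone (`isRegular_of_isPure`). So each boundary point `a` has a least half-space `coreSpace v a`, and
spanning for τ' reduces to `Spans`.

The crux is an exchange argument, `toProj_mem_of_irredundant`: if a half-space at `a` is needed to
cut the cone out of a tropically convex set P, then `a` belongs to every finite spanning set. A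
small move inside P from `a` out of the cone violates the half-space of some spanning `b`; a small
move from `b` towards the offending point leaves the cone again and violates the one at `a`.
Tracking the sectors responsible gives an index maximizing both a - b and b - a, so `a` and `b`
agree projectively.

Hence a minimal spanning set lies in every finite one, is unique, and equals the set of apices of
any non-redundant representation. A finite spanning set exists because outside points are separated
by half-spaces at vertices (`exists_separating_vertex`), of which there are finitely many. Two
members of a representation cannot share an apex (`IsNonRedundantRep.eq_of_hasApex`): a combination
of their witnesses would lie in the cone. Finally, a half-space strictly inside `coreSpace v a`
would let `a` be traded for another apex, which exchange forbids; so the core half-spaces are the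
minimal ones. -/

open Filter Topology

namespace TropicalCone

variable {n p : ℕ}

/-! ### Sectors and half-spaces -/

/-- The set of indices at which `x - a` is maximal. -/
def argTop (x a : Fin n → ℝ) : Set (Fin n) := {i | ∀ j, x j - a j ≤ x i - a i}

lemma argTop_nonempty [Nonempty (Fin n)] (x a : Fin n → ℝ) : (argTop x a).Nonempty := by
  obtain ⟨i, hi⟩ := Finite.exists_max (fun i => x i - a i)
  exact ⟨i, hi⟩

lemma argTop_congr {a b : Fin n → ℝ} {c : ℝ} (h : ∀ i, a i = b i + c) (x : Fin n → ℝ) :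
    argTop x a = argTop x b := by
  ext i
  simp only [argTop, Set.mem_ofPred_eq, h]
  exact forall_congr' fun j => ⟨fun h => by linarith, fun h => by linarith⟩

lemma argTop_add_const (x a : Fin n → ℝ) (c : ℝ) :
    argTop (fun i => x i + c) a = argTop x a := by
  ext i
  simp only [argTop, Set.mem_ofPred_eq]
  exact forall_congr' fun j => ⟨fun h => by linarith, fun h => by linarith⟩

/-- `x` lies in the half-space `H(a, I)`. -/
def Meets (I : Finset (Fin n)) (a x : Fin n → ℝ) : Prop := ∃ i ∈ I, i ∈ argTop x a

lemma meets_iff {I : Finset (Fin n)} {a x : Fin n → ℝ} (hI : I.Nonempty) :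
    Meets I a x ↔ ∃ i ∈ I, ∀ j ∈ Iᶜ, x j - a j ≤ x i - a i := by
  constructor
  · rintro ⟨i, hi, h⟩
    exact ⟨i, hi, fun j _ => h j⟩
  · rintro ⟨i, hi, h⟩
    obtain ⟨k, hk, hmax⟩ := I.exists_max_image (fun i => x i - a i) hI
    refine ⟨k, hk, fun j => ?_⟩
    by_cases hj : j ∈ I
    · exact hmax j hj
    · exact (h j (by simpa using hj)).trans (hmax i hi)

lemma Meets.sup {I : Finset (Fin n)} {a x y : Fin n → ℝ} (hx : Meets I a x) (hy : Meets I a y) :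
    Meets I a (x ⊔ y) := by
  obtain ⟨i, hi, hx⟩ := hx
  obtain ⟨k, hk, hy⟩ := hy
  rcases le_total (x i - a i) (y k - a k) with h | h
  · refine ⟨k, hk, fun j => ?_⟩
    have := le_sup_right (a := x k) (b := y k)
    rcases le_total (x j) (y j) with h' | h' <;> simp only [Pi.sup_apply, h', sup_of_le_left,
      sup_of_le_right]
    · linarith [hy j]
    · linarith [hx j]
  · refine ⟨i, hi, fun j => ?_⟩
    have := le_sup_left (a := x i) (b := y i)
    rcases le_total (x j) (y j) with h' | h' <;> simp only [Pi.sup_apply, h', sup_of_le_left,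
      sup_of_le_right]
    · linarith [hy j]
    · linarith [hx j]

lemma Meets.add_const {I : Finset (Fin n)} {a x : Fin n → ℝ} (hx : Meets I a x) (c : ℝ) :
    Meets I a (fun i => x i + c) := by
  obtain ⟨i, hi, hx⟩ := hx
  exact ⟨i, hi, by rwa [argTop_add_const]⟩

lemma ofReal_mem_halfSpace {a x : Fin n → ℝ} {I J : Finset (Fin n)} (hI : I.Nonempty) :
    ofReal x ∈ halfSpace a I J ↔ ∃ i ∈ I, ∀ j ∈ J, x j - a j ≤ x i - a i := by
  have key : ∀ i, ofReal x i + ((-a i : ℝ) : WithBot ℝ) = ((x i - a i : ℝ) : WithBot ℝ) := by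
    intro i
    simp [ofReal, sub_eq_add_neg]
  simp only [halfSpace, Set.mem_ofPred_eq, key]
  constructor
  · intro h
    obtain ⟨i, hi, he⟩ := Finset.exists_mem_eq_sup I hI (fun i => ((x i - a i : ℝ) : WithBot ℝ))
    refine ⟨i, hi, fun j hj => ?_⟩
    rw [he, Finset.sup_le_iff] at h
    exact WithBot.coe_le_coe.1 (h j hj)
  · rintro ⟨i, hi, h⟩
    refine Finset.sup_le fun j hj => ?_
    exact (WithBot.coe_le_coe.2 (h j hj)).trans
      (Finset.le_sup (f := fun i => ((x i - a i : ℝ) : WithBot ℝ)) hi)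

lemma ofReal_mem_halfSpace_compl {a x : Fin n → ℝ} {I : Finset (Fin n)} (hI : I.Nonempty) :
    ofReal x ∈ halfSpace a I Iᶜ ↔ Meets I a x := by
  rw [ofReal_mem_halfSpace hI, meets_iff hI]

lemma halfSpace_congr {a b : Fin n → ℝ} {c : ℝ} (h : ∀ i, a i = b i + c) (I J : Finset (Fin n)) :
    halfSpace a I J = halfSpace b I J := by
  have key : ∀ (b : Fin n → ℝ) (c : ℝ), halfSpace b I J ⊆ halfSpace (fun i => b i + c) I J := by
    intro b c x hx
    simp only [halfSpace, Set.mem_ofPred_eq] at hx ⊢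
    have e : ∀ i, x i + ((-(b i + c) : ℝ) : WithBot ℝ) =
        x i + ((-b i : ℝ) : WithBot ℝ) + ((-c : ℝ) : WithBot ℝ) := by
      intro i
      rw [neg_add, WithBot.coe_add, add_assoc]
    simp only [e]
    refine Finset.sup_le fun j hj => ?_
    have hj' : x j + ((-b j : ℝ) : WithBot ℝ) ≤ _ := (Finset.le_sup hj).trans hx
    rcases I.eq_empty_or_nonempty with rfl | hI
    · simp only [Finset.sup_empty, le_bot_iff] at hj' ⊢
      simp [hj']
    · obtain ⟨i, hi, he⟩ := Finset.exists_mem_eq_sup I hI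
        (fun i => x i + ((-b i : ℝ) : WithBot ℝ))
      rw [he] at hj'
      exact (add_le_add_left hj' _).trans (Finset.le_sup (f := fun i => x i +
        ((-b i : ℝ) : WithBot ℝ) + ((-c : ℝ) : WithBot ℝ)) hi)
  apply Set.Subset.antisymm
  · have := key a (-c)
    simpa [h] using this
  · have := key b c
    rwa [← funext h] at this

lemma halfSpace_mono (a : Fin n → ℝ) {I I' J J' : Finset (Fin n)} (hI : I ⊆ I') (hJ : J' ⊆ J) :
    halfSpace a I J ⊆ halfSpace a I' J' := by
  intro x hx
  simp only [halfSpace, Set.mem_ofPred_eq] at hx ⊢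
  exact (Finset.sup_mono hJ).trans (hx.trans (Finset.sup_mono hI))

lemma sup_mem_halfSpace {a : Fin n → ℝ} {I J : Finset (Fin n)} {x y : Fin n → WithBot ℝ}
    (hx : x ∈ halfSpace a I J) (hy : y ∈ halfSpace a I J) : x ⊔ y ∈ halfSpace a I J := by
  simp only [halfSpace, Set.mem_ofPred_eq] at hx hy ⊢
  refine Finset.sup_le fun j hj => ?_
  rcases le_total (x j) (y j) with h | h
  · simp only [Pi.sup_apply, h, sup_of_le_right]
    refine ((Finset.le_sup (f := fun j => y j + ((-a j : ℝ) : WithBot ℝ)) hj).trans hy).trans ?_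
    exact Finset.sup_mono_fun fun i _ => by gcongr; exact le_sup_right
  · simp only [Pi.sup_apply, h, sup_of_le_left]
    refine ((Finset.le_sup (f := fun j => x j + ((-a j : ℝ) : WithBot ℝ)) hj).trans hx).trans ?_
    exact Finset.sup_mono_fun fun i _ => by gcongr; exact le_sup_left

/-- Filling the ⊥ entries with sufficiently negative reals does not repair a strictly violated
inequality. -/
lemma exists_real_not_mem_halfSpace {a : Fin n → ℝ} {I J : Finset (Fin n)}
    {x : Fin n → WithBot ℝ} (hx : x ∉ halfSpace a I J) (c : Fin n → ℝ) :
    ∃ t : ℝ, x ⊔ ofReal (fun i => c i + t) ∉ halfSpace a I J := by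
  simp only [halfSpace, Set.mem_ofPred_eq, not_le, Finset.lt_sup_iff] at hx ⊢
  obtain ⟨j, hj, hlt⟩ := hx
  have hne : x j ≠ ⊥ := by
    intro h
    simp [h] at hlt
  obtain ⟨s, hs⟩ := WithBot.ne_bot_iff_exists.1 hne
  obtain ⟨B, hB⟩ := (Set.finite_range fun i => c i - a i).bddAbove
  -- With this shift, every added term `c i + t - a i` is at most `x j - a j - 1`.
  refine ⟨s - a j - 1 - B, j, hj, lt_of_lt_of_le ?_ (b := x j + ((-a j : ℝ) : WithBot ℝ))
    (by gcongr; exact le_sup_left)⟩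
  have hpos := bot_le.trans_lt hlt
  rw [Finset.sup_lt_iff hpos] at hlt ⊢
  intro i hi
  rcases le_total (x i) (ofReal (fun i => c i + (s - a j - 1 - B)) i) with h | h
  · rw [Pi.sup_apply, sup_of_le_right h, ← hs, ofReal, ← WithBot.coe_add, ← WithBot.coe_add,
      WithBot.coe_lt_coe]
    have : c i - a i ≤ B := hB ⟨i, rfl⟩
    linarith
  · rw [Pi.sup_apply, sup_of_le_left h]
    exact hlt i hi

lemma exists_sup_ofReal_eq (x : Fin n → WithBot ℝ) (c : Fin n → ℝ) :
    ∃ z : Fin n → ℝ, ofReal z = x ⊔ ofReal c := by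
  have : ∀ i, ∃ z : ℝ, (z : WithBot ℝ) = (x ⊔ ofReal c) i := by
    intro i
    refine WithBot.ne_bot_iff_exists.1 fun h => ?_
    rw [Pi.sup_apply, sup_eq_bot_iff] at h
    exact WithBot.coe_ne_bot h.2
  choose z hz using this
  exact ⟨z, funext hz⟩

/-- Real test points suffice: a bad point joined with a low translate of `c` stays in all members of
Γ, becomes real and remains bad. -/
lemma sInter_subset_halfSpace {Γ : Set (Set (Fin n → WithBot ℝ))}
    (hΓ : ∀ K ∈ Γ, ∃ a I J, K = halfSpace a I J) {c : Fin n → ℝ}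
    (hc : ∀ t : ℝ, ∀ K ∈ Γ, ofReal (fun i => c i + t) ∈ K) {a : Fin n → ℝ} {I J : Finset (Fin n)}
    (h : ∀ x, (∀ K ∈ Γ, ofReal x ∈ K) → ofReal x ∈ halfSpace a I J) :
    ⋂₀ Γ ⊆ halfSpace a I J := by
  intro x hx
  by_contra hxa
  obtain ⟨t, ht⟩ := exists_real_not_mem_halfSpace hxa c
  obtain ⟨z, hz⟩ := exists_sup_ofReal_eq x (fun i => c i + t)
  rw [← hz] at ht
  refine ht (h z fun K hK => ?_)
  rw [hz]
  have h1 := hc t K hK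
  have h2 := hx K hK
  obtain ⟨b, I', J', rfl⟩ := hΓ K hK
  exact sup_mem_halfSpace h2 h1

/-! ### Membership in the cone -/

/-- Membership of a real vector in the cone generated by `v`. -/
def InCone (v : Fin p → Fin n → ℝ) (a : Fin n → ℝ) : Prop := ∀ i, ∃ r, i ∈ argTop (v r) a

/-- The generators attaining the maximum at `i` are those whose difference with `x` is maximal at
`i`. Conversely, the coefficient of `v r` is the largest scalar keeping its multiple below `x`. -/
lemma ofReal_mem_generatedCone {v : Fin p → Fin n → ℝ} {x : Fin n → ℝ} :
    ofReal x ∈ generatedCone v ↔ InCone v x := by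
  constructor
  · rintro ⟨c, hc⟩ i
    have hne : (Finset.univ : Finset (Fin p)).Nonempty := by
      by_contra h
      have := hc i
      rw [Finset.not_nonempty_iff_eq_empty.1 h] at this
      exact WithBot.coe_ne_bot this
    obtain ⟨r, -, hr⟩ := Finset.exists_mem_eq_sup Finset.univ hne
      (fun r => c r + (v r i : WithBot ℝ))
    rw [← hc i] at hr
    have hcr : c r ≠ ⊥ := by
      intro h
      rw [h, WithBot.bot_add] at hr
      exact WithBot.coe_ne_bot hr
    obtain ⟨l, hl⟩ := WithBot.ne_bot_iff_exists.1 hcr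
    refine ⟨r, fun j => ?_⟩
    have hj : c r + (v r j : WithBot ℝ) ≤ ofReal x j := by
      rw [hc j]
      exact Finset.le_sup (f := fun r => c r + (v r j : WithBot ℝ)) (Finset.mem_univ r)
    rw [← hl, ofReal, ← WithBot.coe_add] at hj hr
    have h1 := WithBot.coe_le_coe.1 hj
    have h2 := WithBot.coe_injective hr
    linarith
  · intro h
    rcases isEmpty_or_nonempty (Fin n) with _ | _
    · exact ⟨fun _ => ⊥, fun i => isEmptyElim i⟩
    choose k hk using fun r => argTop_nonempty (v r) x
    refine ⟨fun r => ((x (k r) - v r (k r) : ℝ) : WithBot ℝ), fun i => ?_⟩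
    simp only [← WithBot.coe_add, ofReal]
    apply le_antisymm
    · obtain ⟨r, hr⟩ := h i
      refine le_trans ?_ (Finset.le_sup (Finset.mem_univ r))
      rw [WithBot.coe_le_coe]
      linarith [hr (k r)]
    · refine Finset.sup_le fun r _ => ?_
      rw [WithBot.coe_le_coe]
      linarith [hk r i]

lemma inCone_generator (v : Fin p → Fin n → ℝ) (r : Fin p) : InCone v (v r) :=
  fun _ => ⟨r, fun j => by simp⟩

lemma InCone.add_const {v : Fin p → Fin n → ℝ} {a b : Fin n → ℝ} {c : ℝ} (ha : InCone v b)
    (h : ∀ i, a i = b i + c) : InCone v a := by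
  intro i
  obtain ⟨r, hr⟩ := ha i
  exact ⟨r, by rwa [argTop_congr h]⟩

lemma generatedCone_subset_halfSpace {v : Fin p → Fin n → ℝ} {a : Fin n → ℝ}
    {I J : Finset (Fin n)} :
    generatedCone v ⊆ halfSpace a I J ↔ ∀ r, ofReal (v r) ∈ halfSpace a I J := by
  constructor
  · exact fun h r => h (ofReal_mem_generatedCone.2 (inCone_generator v r))
  · rintro h x ⟨c, hc⟩
    simp only [halfSpace, Set.mem_ofPred_eq]
    refine Finset.sup_le fun j hj => ?_
    rw [hc j]
    rcases Finset.eq_empty_or_nonempty (Finset.univ : Finset (Fin p)) with he | hne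
    · simp [he]
    obtain ⟨r, -, hr⟩ := Finset.exists_mem_eq_sup Finset.univ hne
      (fun r => c r + (v r j : WithBot ℝ))
    rw [hr]
    rcases I.eq_empty_or_nonempty with rfl | hI
    · have := (Finset.le_sup (f := fun j => ofReal (v r) j + ((-a j : ℝ) : WithBot ℝ)) hj).trans
        (h r)
      rw [Finset.sup_empty, le_bot_iff] at this
      exact absurd this WithBot.coe_ne_bot
    obtain ⟨i, hi, hij⟩ := (ofReal_mem_halfSpace hI).1 (h r)
    refine le_trans ?_ (Finset.le_sup (f := fun i => x i + ((-a i : ℝ) : WithBot ℝ)) hi)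
    have h1 : c r + (v r i : WithBot ℝ) ≤ x i := by
      rw [hc i]
      exact Finset.le_sup (f := fun r => c r + (v r i : WithBot ℝ)) (Finset.mem_univ r)
    refine le_trans ?_ (add_le_add_left h1 _)
    rw [add_assoc, add_assoc, ← WithBot.coe_add, ← WithBot.coe_add]
    gcongr
    rw [WithBot.coe_le_coe]
    linarith [hij j hj]

lemma generatedCone_subset_halfSpace_compl {v : Fin p → Fin n → ℝ} {a : Fin n → ℝ}
    {I : Finset (Fin n)} (hI : I.Nonempty) :
    generatedCone v ⊆ halfSpace a I Iᶜ ↔ ∀ r, Meets I a (v r) := by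
  simp only [generatedCone_subset_halfSpace, ofReal_mem_halfSpace_compl hI]

lemma InCone.meets {v : Fin p → Fin n → ℝ} {a x : Fin n → ℝ} {I : Finset (Fin n)}
    (hI : I.Nonempty) (h : ∀ r, Meets I a (v r)) (hx : InCone v x) : Meets I a x :=
  (ofReal_mem_halfSpace_compl hI).1
    ((generatedCone_subset_halfSpace_compl hI).2 h (ofReal_mem_generatedCone.2 hx))

/-- A family of half-spaces whose real points are all in the cone cuts out the cone. -/
lemma sInter_subset_generatedCone {v : Fin p → Fin n → ℝ} (hp : 0 < p)
    {Γ : Set (Set (Fin n → WithBot ℝ))}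
    (hΓ : ∀ K ∈ Γ, ∃ a I J, K = halfSpace a I J) (hΓv : ∀ K ∈ Γ, generatedCone v ⊆ K)
    (h : ∀ x, (∀ K ∈ Γ, ofReal x ∈ K) → InCone v x) :
    ⋂₀ Γ ⊆ generatedCone v := by
  intro x hx
  have hc : ∀ t : ℝ, ∀ K ∈ Γ, ofReal (fun i => v ⟨0, hp⟩ i + t) ∈ K := fun t K hK =>
    hΓv K hK (ofReal_mem_generatedCone.2 ((inCone_generator v _).add_const fun _ => rfl))
  by_cases hbot : ∃ i, x i = ⊥
  · obtain ⟨i, hi⟩ := hbot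
    have hall : ∀ j, x j = ⊥ := by
      intro j
      obtain ⟨B, hB⟩ := (Set.finite_range fun r => v r j - v r i).bddAbove
      -- Differences of generator coordinates are bounded, so for `j ≠ i` the cone satisfies `x j ≤
      -- B + x i`; this carries ⊥ from `i` to `j`.
      have hsub : ⋂₀ Γ ⊆ halfSpace (fun k => if k = j then B else 0) {i} {j} := by
        refine sInter_subset_halfSpace hΓ hc fun y hy => ?_
        refine generatedCone_subset_halfSpace.2 (fun r => ?_) (ofReal_mem_generatedCone.2 (h y hy))
        rw [ofReal_mem_halfSpace (Finset.singleton_nonempty i)]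
        have : v r j - v r i ≤ B := hB ⟨r, rfl⟩
        by_cases hij : i = j
        · simp [hij]
        · simp only [Finset.mem_singleton, forall_eq, exists_eq_left, hij, if_true, if_false]
          linarith
      have := hsub hx
      simp only [halfSpace, Set.mem_ofPred_eq, Finset.sup_singleton, hi, WithBot.bot_add,
        le_bot_iff, WithBot.add_eq_bot] at this
      simpa using this
    exact ⟨fun _ => ⊥, fun j => by simp [hall j]⟩
  · push Not at hbot
    choose z hz using fun i => WithBot.ne_bot_iff_exists.1 (hbot i)
    have : ofReal z = x := funext hz
    rw [← this]
    exact ofReal_mem_generatedCone.2 (h z fun K hK => by rw [this]; exact hx K hK)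

/-! ### Projective classes and the core -/

lemma toProj_eq_iff {a b : Fin n → ℝ} : toProj a = toProj b ↔ ∃ c : ℝ, ∀ i, a i = b i + c := by
  rw [toProj, toProj, Submodule.Quotient.eq, Submodule.mem_span_singleton]
  refine exists_congr fun c => ?_
  rw [funext_iff]
  refine forall_congr' fun i => ?_
  simp only [Pi.smul_apply, Pi.one_apply, smul_eq_mul, mul_one, Pi.sub_apply]
  constructor <;> intro h <;> linarith

lemma toProj_surjective (α : ProjSpace n) : ∃ a, toProj a = α := Submodule.Quotient.mk_surjective _ α

lemma toProj_mem_projImage {v : Fin p → Fin n → ℝ} {a : Fin n → ℝ} :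
    toProj a ∈ projImage (generatedCone v) ↔ InCone v a := by
  constructor
  · rintro ⟨b, hb, hab⟩
    obtain ⟨c, hc⟩ := toProj_eq_iff.1 hab.symm
    exact (ofReal_mem_generatedCone.1 hb).add_const hc
  · exact fun h => ⟨a, ofReal_mem_generatedCone.2 h, rfl⟩

/-- The indices `i` such that some generator lies in the open sector `i` at `a`. -/
noncomputable def core (v : Fin p → Fin n → ℝ) (a : Fin n → ℝ) : Finset (Fin n) :=
  (Set.toFinite {i | ∃ r, argTop (v r) a = {i}}).toFinset

lemma mem_core {v : Fin p → Fin n → ℝ} {a : Fin n → ℝ} {i : Fin n} :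
    i ∈ core v a ↔ ∃ r, argTop (v r) a = {i} := by
  simp [core]

lemma core_congr {v : Fin p → Fin n → ℝ} {a b : Fin n → ℝ} {c : ℝ} (h : ∀ i, a i = b i + c) :
    core v a = core v b := by
  ext i
  simp only [mem_core, argTop_congr h]

lemma meets_core_congr {v : Fin p → Fin n → ℝ} {a b : Fin n → ℝ} (h : toProj a = toProj b)
    {y : Fin n → ℝ} (hb : Meets (core v b) b y) : Meets (core v a) a y := by
  obtain ⟨c, hc⟩ := toProj_eq_iff.1 h
  obtain ⟨i, hi, hy⟩ := hb
  exact ⟨i, by rwa [core_congr hc], by rwa [argTop_congr hc]⟩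

/-- A generator interior to sector `i` can meet `I` only through `i`. -/
lemma core_subset {v : Fin p → Fin n → ℝ} {a : Fin n → ℝ} {I : Finset (Fin n)}
    (h : ∀ r, Meets I a (v r)) : core v a ⊆ I := by
  intro i hi
  obtain ⟨r, hr⟩ := mem_core.1 hi
  obtain ⟨k, hk, hkr⟩ := h r
  rw [hr, Set.mem_singleton_iff] at hkr
  rwa [← hkr]

lemma mem_sigmaAt {v : Fin p → Fin n → ℝ} {a : Fin n → ℝ} {H : Set (Fin n → WithBot ℝ)} :
    H ∈ sigmaAt (generatedCone v) (toProj a) ↔ ∃ I : Finset (Fin n), I.Nonempty ∧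
      I ≠ Finset.univ ∧ H = halfSpace a I Iᶜ ∧ ∀ r, Meets I a (v r) := by
  constructor
  · rintro ⟨hCH, b, I, hI, hI', hab, rfl⟩
    obtain ⟨c, hc⟩ := toProj_eq_iff.1 hab
    rw [halfSpace_congr hc] at hCH ⊢
    exact ⟨I, hI, hI', rfl, (generatedCone_subset_halfSpace_compl hI).1 hCH⟩
  · rintro ⟨I, hI, hI', rfl, h⟩
    exact ⟨(generatedCone_subset_halfSpace_compl hI).2 h, a, I, hI, hI', rfl, rfl⟩

/-! ### Small moves from a point -/

/-- `a` raised by `ε` on `D`. -/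
noncomputable def bump (a : Fin n → ℝ) (D : Set (Fin n)) (ε : ℝ) : Fin n → ℝ :=
  fun i => a i + D.indicator (fun _ => ε) i

lemma bump_of_mem {a : Fin n → ℝ} {D : Set (Fin n)} {i : Fin n} (hi : i ∈ D) (ε : ℝ) :
    bump a D ε i = a i + ε := by
  simp [bump, hi]

lemma bump_of_notMem {a : Fin n → ℝ} {D : Set (Fin n)} {i : Fin n} (hi : i ∉ D) (ε : ℝ) :
    bump a D ε i = a i := by
  simp [bump, hi]

lemma argTop_bump {a : Fin n → ℝ} {D : Set (Fin n)} {ε : ℝ} (hε : 0 < ε) (hD : D.Nonempty) :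
    argTop (bump a D ε) a = D := by
  ext i
  constructor
  · intro hi
    obtain ⟨j, hj⟩ := hD
    by_contra hiD
    have := hi j
    rw [bump_of_mem hj, bump_of_notMem hiD] at this
    linarith
  · intro hi j
    rw [bump_of_mem hi]
    by_cases hj : j ∈ D
    · rw [bump_of_mem hj]
      linarith
    · rw [bump_of_notMem hj]
      linarith

lemma eventually_lt_gap (x a : Fin n → ℝ) {k : Fin n} (hk : k ∈ argTop x a) :
    ∀ᶠ ε in 𝓝[>] (0 : ℝ), ∀ i, i ∉ argTop x a → ε < (x k - a k) - (x i - a i) := by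
  rw [eventually_all]
  intro i
  by_cases hi : i ∈ argTop x a
  · exact Eventually.of_forall fun _ h => absurd hi h
  have : 0 < (x k - a k) - (x i - a i) := by
    by_contra hneg
    exact hi fun j => by linarith [hk j]
  filter_upwards [nhdsWithin_le_nhds (Iio_mem_nhds this)] with ε hε _ using hε

/-- Close to `a`, the tropical segment from `a` to `x` raises `a` on `argTop x a`. -/
lemma eventually_sup_eq_bump [Nonempty (Fin n)] (x a : Fin n → ℝ) :
    ∀ᶠ ε in 𝓝[>] (0 : ℝ), ∃ t : ℝ, a ⊔ (fun i => x i + t) = bump a (argTop x a) ε := by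
  obtain ⟨k, hk⟩ := argTop_nonempty x a
  have hsmall := eventually_lt_gap x a hk
  filter_upwards [hsmall, self_mem_nhdsWithin] with ε hε hpos
  rw [Set.mem_Ioi] at hpos
  refine ⟨ε - (x k - a k), funext fun i => ?_⟩
  rw [Pi.sup_apply]
  by_cases hi : i ∈ argTop x a
  · have := hi k
    have := hk i
    rw [bump_of_mem hi, sup_of_le_right (by linarith)]
    linarith
  · rw [bump_of_notMem hi, sup_of_le_left]
    linarith [hε i hi]

/-- For small ε no index outside `argTop b a` can catch up, and a maximal index outside `N` was not
raised, so it could not beat the index of `I` that was maximal for `b`. -/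
lemma eventually_argTop_bump_subset [Nonempty (Fin n)] (b a : Fin n → ℝ) (N : Set (Fin n)) :
    ∀ᶠ ε in 𝓝[>] (0 : ℝ), ∀ I : Finset (Fin n), Meets I a b → ¬ Meets I a (bump b N ε) →
      argTop (bump b N ε) a ⊆ argTop b a ∩ N := by
  obtain ⟨k, hk⟩ := argTop_nonempty b a
  have hsmall := eventually_lt_gap b a hk
  filter_upwards [hsmall, self_mem_nhdsWithin] with ε hε hpos I hI hnI i hi
  rw [Set.mem_Ioi] at hpos
  have hle : ∀ j, b j ≤ bump b N ε j ∧ bump b N ε j ≤ b j + ε := by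
    intro j
    by_cases hj : j ∈ N
    · rw [bump_of_mem hj]
      constructor <;> linarith
    · rw [bump_of_notMem hj]
      constructor <;> linarith
  constructor
  · by_contra hia
    have := hε i hia
    linarith [hi k, (hle k).1, (hle i).2]
  · by_contra hiN
    obtain ⟨l, hl, hla⟩ := hI
    refine hnI ⟨l, hl, fun j => ?_⟩
    have h1 := hi j
    rw [bump_of_notMem hiN] at h1
    linarith [hla i, (hle l).1]

/-! ### Regularity and the exchange argument -/

/-- At each point of the cone, the core is the least `I` such that `H(a, I)` contains it. -/
def IsRegular (v : Fin p → Fin n → ℝ) : Prop :=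
  ∀ a, InCone v a → ∀ r, Meets (core v a) a (v r)

lemma IsRegular.meets {v : Fin p → Fin n → ℝ} (hv : IsRegular v) {a x : Fin n → ℝ}
    (ha : InCone v a) (hx : InCone v x) (hc : (core v a).Nonempty) : Meets (core v a) a x :=
  hx.meets hc (hv a ha)

lemma IsRegular.core_nonempty {v : Fin p → Fin n → ℝ} (hv : IsRegular v) {a : Fin n → ℝ}
    (ha : InCone v a) [Nonempty (Fin n)] : (core v a).Nonempty := by
  obtain ⟨r, -⟩ := ha (Classical.arbitrary _)
  obtain ⟨i, hi, -⟩ := hv a ha r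
  exact ⟨i, hi⟩

/-- The intersection of the half-spaces `H(b, core b)`, for `b` in `X`, is the
cone (on real points). -/
def Spans (v : Fin p → Fin n → ℝ) (X : Set (ProjSpace n)) : Prop :=
  ∀ y, (∀ b, toProj b ∈ X → Meets (core v b) b y) → InCone v y

/-- A half-space with apex `a` which cannot be omitted forces `a` into every finite spanning set. -/
lemma toProj_mem_of_irredundant [Nonempty (Fin n)] {v : Fin p → Fin n → ℝ} (hv : IsRegular v)
    {X : Set (ProjSpace n)} (hX : X.Finite) (hXv : ∀ b, toProj b ∈ X → InCone v b)
    (hspan : Spans v X) {a : Fin n → ℝ} {I : Finset (Fin n)} (ha : InCone v a)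
    (hI : ∀ x, InCone v x → Meets I a x) {P : Set (Fin n → ℝ)}
    (hPsup : ∀ x ∈ P, ∀ y ∈ P, x ⊔ y ∈ P) (hPadd : ∀ x ∈ P, ∀ t : ℝ, (fun i => x i + t) ∈ P)
    (hPv : ∀ x, InCone v x → x ∈ P) (hPI : ∀ x ∈ P, Meets I a x → InCone v x)
    {y : Fin n → ℝ} (hy : y ∈ P) (hyI : ¬ Meets I a y) : toProj a ∈ X := by
  have hbump : ∀ b ∈ P, ∀ x ∈ P, ∀ᶠ ε in 𝓝[>] (0 : ℝ), bump b (argTop x b) ε ∈ P := by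
    intro b hb x hx
    filter_upwards [eventually_sup_eq_bump x b] with ε ⟨t, ht⟩
    rw [← ht]
    exact hPsup _ hb _ (hPadd x hx t)
  have hbump' : ∀ (b x : Fin n → ℝ) (J : Finset (Fin n)), ¬ Meets J b x →
      ∀ᶠ ε in 𝓝[>] (0 : ℝ), ¬ Meets J b (bump b (argTop x b) ε) := by
    intro b x J hJ
    filter_upwards [self_mem_nhdsWithin] with ε hε
    unfold Meets at hJ ⊢
    rwa [argTop_bump hε (argTop_nonempty x b)]
  set y' := bump a (argTop y a) with hy'
  -- Points just beyond `a` towards `y` are outside the cone; as `X` is finite, a single class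
  -- excludes them for arbitrarily small ε.
  have hex : ∃ α ∈ X, ∃ᶠ ε in 𝓝[>] (0 : ℝ), ∃ b, toProj b = α ∧ ¬ Meets (core v b) b (y' ε) := by
    by_contra hno
    push Not at hno
    have hall := (eventually_all_finite hX).2 hno
    obtain ⟨ε, hε, hε'⟩ := (hall.and (hbump' a y I hyI)).exists
    exact hε' (hI _ (hspan _ fun b hb => hε _ hb b rfl))
  obtain ⟨α, hα, hfreq⟩ := hex
  obtain ⟨b, rfl⟩ := toProj_surjective α
  have hb := hXv b hα
  have hcb := hv.core_nonempty hb
  obtain ⟨ε, ⟨b', hb', hεb'⟩, hεP, hsub⟩ := (hfreq.and_eventually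
    ((hbump a (hPv a ha) y hy).and (eventually_argTop_bump_subset a b (argTop y a)))).exists
  have hεb : ¬ Meets (core v b) b (y' ε) := fun h => hεb' (meets_core_congr hb' h)
  have hN := hsub _ (hv.meets hb ha hcb) hεb
  obtain ⟨δ, hδP, hδb, hsub'⟩ := ((hbump b (hPv b hb) _ hεP).and ((hbump' b _ _ hεb).and
    (eventually_argTop_bump_subset b a (argTop (y' ε) b)))).exists
  -- The point reached from `b` is still in `P` but violates a half-space containing the cone, so by
  -- `hPI` it must violate H(a, I).
  have hza : ¬ Meets I a (bump b (argTop (y' ε) b) δ) := fun h =>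
    hδb (hv.meets hb (hPI _ hδP h) hcb)
  have hM := hsub' I (hI b hb) hza
  obtain ⟨i, hi⟩ := argTop_nonempty (bump b (argTop (y' ε) b) δ) a
  have h1 := (hM hi).1
  have h2 := (hN (hM hi).2).1
  -- At `i`, both b - a and a - b are maximal, so the difference is constant.
  have : toProj a = toProj b := toProj_eq_iff.2 ⟨a i - b i, fun j => by linarith [h1 j, h2 j]⟩
  rwa [this]

/-! ### Vertices and separation -/

/-- If the type of `a` is separated by `S`, raising `a` on `S` eventually enlarges the type. -/
lemma exists_larger_type [Nonempty (Fin n)] {v : Fin p → Fin n → ℝ} {a : Fin n → ℝ}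
    (ha : InCone v a) {S : Set (Fin n)} (hS : S.Nonempty) (hS' : Sᶜ.Nonempty)
    (hsep : ∀ r, argTop (v r) a ⊆ S ∨ argTop (v r) a ⊆ Sᶜ) :
    ∃ t, 0 < t ∧ (∀ r, argTop (v r) a ⊆ argTop (v r) (bump a S t)) ∧
      ∃ r, argTop (v r) a ≠ argTop (v r) (bump a S t) := by
  choose k hk using fun r => argTop_nonempty (v r) a
  obtain ⟨i₀, hi₀⟩ := hS
  obtain ⟨j₀, hj₀⟩ := hS'
  obtain ⟨r₀, hr₀⟩ := ha i₀
  obtain ⟨⟨r, j⟩, ⟨hr, hj⟩, hmin⟩ := Set.exists_min_image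
    {q : Fin p × Fin n | argTop (v q.1) a ⊆ S ∧ q.2 ∈ Sᶜ}
    (fun q => (v q.1 (k q.1) - a (k q.1)) - (v q.1 q.2 - a q.2)) (Set.toFinite _)
    ⟨(r₀, j₀), (hsep r₀).resolve_right fun h => h hr₀ hi₀, hj₀⟩
  simp only at hr hj hmin
  -- The least raise at which an index outside `S` ties with a type contained in `S`: no old maximal
  -- index is lost and `j` is gained.
  set t := (v r (k r) - a (k r)) - (v r j - a j) with ht
  have hpos : 0 < t := by
    by_contra hneg
    exact hj (hr fun l => by linarith [hk r l])
  have hgrow : ∀ r, argTop (v r) a ⊆ argTop (v r) (bump a S t) := by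
    intro r i hi l
    rcases hsep r with hs | hs
    · rw [bump_of_mem (hs hi)]
      by_cases hl : l ∈ S
      · rw [bump_of_mem hl]
        linarith [hi l]
      · have := hmin (r, l) ⟨hs, hl⟩
        simp only at this
        rw [bump_of_notMem hl]
        linarith [hi (k r)]
    · rw [bump_of_notMem (hs hi)]
      by_cases hl : l ∈ S
      · rw [bump_of_mem hl]
        linarith [hi l]
      · rw [bump_of_notMem hl]
        exact hi l
  refine ⟨t, hpos, hgrow, r, fun heq => hj (hr ?_)⟩
  rw [heq]
  intro l
  have := hgrow r (hk r) l
  rw [bump_of_mem (hr (hk r))] at this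
  rw [bump_of_notMem hj]
  linarith

/-- The type of `a` is connected: it determines the class of `a`. -/
def IsVertex (v : Fin p → Fin n → ℝ) (a : Fin n → ℝ) : Prop :=
  InCone v a ∧ ∀ S : Set (Fin n), S.Nonempty → Sᶜ.Nonempty →
    ¬ ∀ r, argTop (v r) a ⊆ S ∨ argTop (v r) a ⊆ Sᶜ

/-- There are finitely many types. If `a` and `b` share one, b - a is constant on each `argTop (v r)
a`, so a level set of b - a would separate the type unless b - a is constant everywhere. -/
lemma finite_vertices (v : Fin p → Fin n → ℝ) : {α | ∃ a, toProj a = α ∧ IsVertex v a}.Finite := by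
  classical
  let g : (Fin p → Set (Fin n)) → ProjSpace n := fun M =>
    if h : ∃ a, IsVertex v a ∧ (fun r => argTop (v r) a) = M then toProj h.choose else 0
  refine (Set.finite_range g).subset ?_
  rintro _ ⟨a, rfl, ha⟩
  refine ⟨fun r => argTop (v r) a, ?_⟩
  have hex : ∃ b, IsVertex v b ∧ (fun r => argTop (v r) b) = fun r => argTop (v r) a :=
    ⟨a, ha, rfl⟩
  simp only [g, dif_pos hex]
  obtain ⟨hb, hab⟩ := hex.choose_spec
  set b := hex.choose
  rw [toProj_eq_iff]
  rcases isEmpty_or_nonempty (Fin n) with _ | ⟨⟨i⟩⟩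
  · exact ⟨0, fun i => isEmptyElim i⟩
  refine ⟨b i - a i, ?_⟩
  by_contra hne
  push Not at hne
  obtain ⟨j, hj⟩ := hne
  refine ha.2 {l | b l = a l + (b i - a i)} ⟨i, by simp⟩ ⟨j, hj⟩ fun r => ?_
  have hc : ∀ l m, l ∈ argTop (v r) a → m ∈ argTop (v r) a → b l - a l = b m - a m := by
    intro l m hl hm
    have h1 := congrFun hab r
    have hl' := hl
    have hm' := hm
    rw [← h1] at hl' hm'
    linarith [hl m, hm l, hl' m, hm' l]
  by_cases hex : ∃ l ∈ argTop (v r) a, b l = a l + (b i - a i)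
  · obtain ⟨l, hl, hl'⟩ := hex
    refine Or.inl fun m hm => ?_
    have := hc l m hl hm
    show b m = a m + (b i - a i)
    linarith
  · push Not at hex
    exact Or.inr hex

/-- A point outside the cone is separated from it by a half-space with apex in the cone. -/
lemma exists_separating [Nonempty (Fin n)] {v : Fin p → Fin n → ℝ} (hp : 0 < p) {y : Fin n → ℝ}
    (hy : ¬ InCone v y) : ∃ a, InCone v a ∧ ¬ Meets (core v a) a y := by
  have : Nonempty (Fin p) := ⟨⟨0, hp⟩⟩
  choose k hk using fun r => argTop_nonempty (v r) y
  choose r hr using fun i => Finite.exists_max fun r => v r i + (y (k r) - v r (k r))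
  -- The greatest point of the cone below `y`: each generator is raised until it touches `y`, at `k
  -- r`.
  set a : Fin n → ℝ := fun i => v (r i) i + (y (k (r i)) - v (r i) (k (r i))) with ha
  have hay : ∀ i, a i ≤ y i := fun i => by
    simp only [ha]
    linarith [hk (r i) i]
  have hak : ∀ r, a (k r) = y (k r) := fun s => le_antisymm (hay _) (by linarith [hr (k s) s])
  have hkr : ∀ s, k s ∈ argTop (v s) a := by
    intro s j
    rw [hak]
    linarith [hr j s]
  refine ⟨a, fun i => ⟨r i, fun j => ?_⟩, ?_⟩
  · linarith [hr j (r i)]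
  · rintro ⟨i, hi, hiy⟩
    obtain ⟨s, hs⟩ := mem_core.1 hi
    have hks := hkr s
    rw [hs, Set.mem_singleton_iff] at hks
    have hai := hak s
    rw [hks] at hai
    -- Here y - a is maximal at a core index, where it vanishes; hence `y = a`, which is in the
    -- cone.
    refine hy fun j => ?_
    have hj : y j = a j := le_antisymm (by linarith [hiy j]) (hay j)
    refine ⟨r j, fun l => ?_⟩
    have := hr l (r j)
    have := hay l
    rw [hj]
    simp only [ha] at *
    linarith

/-- The apex of the separating half-space can be chosen among finitely many vertices. -/
lemma exists_separating_vertex [Nonempty (Fin n)] {v : Fin p → Fin n → ℝ} (hp : 0 < p)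
    {y : Fin n → ℝ} (hy : ¬ InCone v y) : ∃ a, IsVertex v a ∧ ¬ Meets (core v a) a y := by
  let F : (Fin n → ℝ) → Set (Fin p × Fin n) := fun a => {q | q.2 ∈ argTop (v q.1) a}
  obtain ⟨M, ⟨a, ha, hay, rfl⟩, hmax⟩ := Set.Finite.exists_maximal (s := {M | ∃ a, InCone v a ∧
    ¬ Meets (core v a) a y ∧ F a = M}) (Set.toFinite _) (by
      obtain ⟨a, ha, hay⟩ := exists_separating hp hy
      exact ⟨F a, a, ha, hay, rfl⟩)
  refine ⟨a, ⟨ha, ?_⟩, hay⟩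
  -- Of the two sides of a splitting, the one raised must miss an index of `argTop y a`; then
  -- raising it preserves separation from `y`, while the type grows against maximality.
  suffices hmain : ∀ S : Set (Fin n), S.Nonempty → Sᶜ.Nonempty → (∃ i ∈ argTop y a, i ∉ S) →
      ¬ ∀ r, argTop (v r) a ⊆ S ∨ argTop (v r) a ⊆ Sᶜ by
    intro S hS hS' hsep
    obtain ⟨i, hi⟩ := argTop_nonempty y a
    by_cases hiS : i ∈ S
    · refine hmain Sᶜ hS' (by rwa [compl_compl]) ⟨i, hi, fun h => h hiS⟩ fun r => ?_
      rw [compl_compl]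
      exact (hsep r).symm
    · exact hmain S hS hS' ⟨i, hi, hiS⟩ hsep
  intro S hS hS' ⟨i, hi, hiS⟩ hsep
  obtain ⟨t, ht, hgrow, r, hr⟩ := exists_larger_type ha hS hS' hsep
  -- Larger types leave fewer singletons.
  have hcore : core v (bump a S t) ⊆ core v a := by
    intro j hj
    obtain ⟨s, hs⟩ := mem_core.1 hj
    refine mem_core.2 ⟨s, ?_⟩
    exact (argTop_nonempty (v s) a).subset_singleton_iff.1 ((hgrow s).trans hs.subset)
  have hle := hmax (y := F (bump a S t)) ⟨bump a S t, ?_, ?_, rfl⟩ (fun q hq => hgrow q.1 hq)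
  · exact hr ((hgrow r).antisymm fun j hj => hle (a := (r, j)) hj)
  · intro j
    obtain ⟨s, hs⟩ := ha j
    exact ⟨s, hgrow s hs⟩
  · rintro ⟨j, hj, hjy⟩
    refine hay ⟨j, hcore hj, fun l => (hi l).trans ?_⟩
    have h1 := hjy i
    rw [bump_of_notMem hiS] at h1
    by_cases hjS : j ∈ S
    · rw [bump_of_mem hjS] at h1
      linarith
    · rwa [bump_of_notMem hjS] at h1

/-! ### Interior, boundary and purity -/

lemma isOpenMap_toProj : IsOpenMap (toProj : (Fin n → ℝ) → ProjSpace n) :=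
  Submodule.isOpenMap_mkQ _

lemma continuous_toProj : Continuous (toProj : (Fin n → ℝ) → ProjSpace n) :=
  (Submodule.span ℝ {(1 : Fin n → ℝ)}).mkQ.continuous_of_finiteDimensional

/-- The point raised slightly at `i` is still in the cone; a generator in its sector `i` lies in the
open sector `i` at `a`. -/
lemma mem_core_of_mem_interior {v : Fin p → Fin n → ℝ} {a : Fin n → ℝ}
    (ha : toProj a ∈ interior (projImage (generatedCone v))) (i : Fin n) : i ∈ core v a := by
  have hnhds : ∀ᶠ y in 𝓝 a, InCone v y := by
    filter_upwards [continuous_toProj.continuousAt.preimage_mem_nhds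
      (mem_interior_iff_mem_nhds.1 ha)] with y hy
    exact toProj_mem_projImage.1 hy
  have hcont : Tendsto (fun δ => bump a {i} δ) (𝓝[>] (0 : ℝ)) (𝓝 a) := by
    have : Continuous fun δ => bump a {i} δ := by
      refine continuous_pi fun j => ?_
      by_cases hj : j ∈ ({i} : Set (Fin n))
      · simp only [bump_of_mem hj]
        fun_prop
      · simp only [bump_of_notMem hj]
        fun_prop
    have h0 : bump a {i} 0 = a := by
      ext j
      simp [bump]
    have h := this.tendsto 0
    simp only [h0] at h
    exact h.mono_left nhdsWithin_le_nhds
  obtain ⟨δ, hδ, hpos⟩ := ((hcont.eventually hnhds).and self_mem_nhdsWithin).exists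
  replace hpos : 0 < δ := hpos
  obtain ⟨r, hr⟩ := hδ i
  have hlt : ∀ j, j ≠ i → v r j - a j < v r i - a i := by
    intro j hj
    have := hr j
    rw [bump_of_mem (Set.mem_singleton i), bump_of_notMem (by simpa using hj)] at this
    linarith
  refine mem_core.2 ⟨r, Set.eq_singleton_iff_unique_mem.2 ⟨fun j => ?_, fun j hj => ?_⟩⟩
  · by_cases hj : j = i
    · rw [hj]
    · exact (hlt j hj).le
  · by_contra hji
    linarith [hj i, hlt j hji]

lemma mem_interior_of_core_eq_univ {v : Fin p → Fin n → ℝ} {a : Fin n → ℝ}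
    (ha : core v a = Finset.univ) : toProj a ∈ interior (projImage (generatedCone v)) := by
  have hcore : ∀ i, ∃ r, argTop (v r) a = {i} := fun i => mem_core.1 (ha ▸ Finset.mem_univ i)
  choose r hr using hcore
  have hev : ∀ᶠ y in 𝓝 a, ∀ i j, j ≠ i → v (r i) j - y j < v (r i) i - y i := by
    simp only [eventually_all]
    intro i j hj
    have hlt : v (r i) j - a j < v (r i) i - a i := by
      by_contra hle
      have hi : i ∈ argTop (v (r i)) a := by rw [hr i]; rfl
      have : j ∈ argTop (v (r i)) a := fun l => by linarith [hi l]
      rw [hr i] at this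
      exact hj this
    have h1 : Continuous fun y : Fin n → ℝ => v (r i) j - y j := by fun_prop
    have h2 : Continuous fun y : Fin n → ℝ => v (r i) i - y i := by fun_prop
    exact h1.continuousAt.eventually_lt h2.continuousAt hlt
  rw [mem_interior_iff_mem_nhds]
  filter_upwards [isOpenMap_toProj.image_mem_nhds hev] with _ ⟨y, hy, h⟩
  rw [← h]
  refine toProj_mem_projImage.2 fun i => ⟨r i, fun j => ?_⟩
  by_cases hj : j = i
  · rw [hj]
  · exact (hy i j hj).le

lemma InCone.sup_generator {v : Fin p → Fin n → ℝ} {a : Fin n → ℝ} (ha : InCone v a) (r : Fin p)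
    (t : ℝ) : InCone v (a ⊔ fun i => v r i + t) := by
  intro i
  obtain ⟨s, hs⟩ := ha i
  rcases le_total (a i) (v r i + t) with hi | hi
  · refine ⟨r, fun j => ?_⟩
    have := le_sup_right (a := a j) (b := v r j + t)
    simp only [Pi.sup_apply, sup_of_le_right hi]
    linarith
  · refine ⟨s, fun j => ?_⟩
    have := le_sup_left (a := a j) (b := v r j + t)
    simp only [Pi.sup_apply, sup_of_le_left hi]
    linarith [hs j]

/-- Move from `a` slightly towards `v r`. By purity an interior point `y` is nearby, and y - a is
maximal at some `i` in the type of `v r`. A generator in the open sector `i` at `y` is also in the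
open sector `i` at `a`, so `i` is a core index. -/
lemma isRegular_of_isPure [Nonempty (Fin n)] {v : Fin p → Fin n → ℝ} (h : IsPure (generatedCone v)) :
    IsRegular v := by
  intro a ha r
  obtain ⟨ε, ⟨t, ht⟩, hε⟩ := ((eventually_sup_eq_bump (v r) a).and self_mem_nhdsWithin).exists
  replace hε : 0 < ε := hε
  set c := bump a (argTop (v r) a) ε with hc
  have hcl : toProj c ∈ closure (interior (projImage (generatedCone v))) := by
    unfold IsPure at h
    rw [← h, toProj_mem_projImage, ← ht]
    exact ha.sup_generator r t
  obtain ⟨_, ⟨y, hy, rfl⟩, hyint⟩ := mem_closure_iff.1 hcl _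
    (isOpenMap_toProj _ (Metric.isOpen_ball (x := c) (ε := ε / 2)))
    ⟨c, Metric.mem_ball_self (by linarith), rfl⟩
  have hyc : ∀ j, |y j - c j| < ε / 2 := by
    intro j
    rw [← Real.dist_eq]
    exact lt_of_le_of_lt (dist_le_pi_dist y c j) hy
  obtain ⟨i, hi⟩ := argTop_nonempty y a
  have hiD : i ∈ argTop (v r) a := by
    by_contra hiD
    obtain ⟨k, hk⟩ := argTop_nonempty (v r) a
    have h1 := abs_lt.1 (hyc i)
    have h2 := abs_lt.1 (hyc k)
    rw [hc, bump_of_notMem hiD] at h1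
    rw [hc, bump_of_mem hk] at h2
    linarith [hi k]
  obtain ⟨s, hs⟩ := mem_core.1 (mem_core_of_mem_interior hyint i)
  have hsi : i ∈ argTop (v s) y := by rw [hs]; rfl
  refine ⟨i, mem_core.2 ⟨s, Set.eq_singleton_iff_unique_mem.2 ⟨fun j => ?_, fun j hj => ?_⟩⟩, hiD⟩
  · linarith [hsi j, hi j]
  · have : j ∈ argTop (v s) y := fun l => by linarith [hj i, hi j, hsi l]
    rwa [hs] at this

lemma toProj_mem_boundary {v : Fin p → Fin n → ℝ} (h : IsPure (generatedCone v))
    {a : Fin n → ℝ} :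
    toProj a ∈ boundary (generatedCone v) ↔ InCone v a ∧ core v a ≠ Finset.univ := by
  have hcl : IsClosed (projImage (generatedCone v)) := by
    unfold IsPure at h
    rw [h]
    exact isClosed_closure
  rw [boundary, hcl.frontier_eq, Set.mem_sdiff, toProj_mem_projImage]
  refine and_congr_right fun _ => not_congr ⟨fun h => ?_, mem_interior_of_core_eq_univ⟩
  exact Finset.eq_univ_iff_forall.2 (mem_core_of_mem_interior h)

/-! ### Inclusions between half-spaces -/

/-- Tested on the tropical unit vector at `j`. -/
lemma subset_of_halfSpace_subset {a b : Fin n → ℝ} {I J I' J' : Finset (Fin n)}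
    (hIJ : Disjoint I J) (h : halfSpace b I' J' ⊆ halfSpace a I J) : J ⊆ J' := by
  intro j hj
  by_contra hj'
  have hmem : (fun k => if k = j then (0 : WithBot ℝ) else ⊥) ∈ halfSpace b I' J' := by
    simp only [halfSpace, Set.mem_ofPred_eq]
    refine Finset.sup_le fun k hk => ?_
    have : k ≠ j := fun h => hj' (h ▸ hk)
    simp [this]
  have hmem' := h hmem
  simp only [halfSpace, Set.mem_ofPred_eq] at hmem'
  rw [Finset.sup_le_iff] at hmem'
  have h1 := hmem' j hj
  have h2 : I.sup (fun i => (if i = j then (0 : WithBot ℝ) else ⊥) + ((-a i : ℝ) : WithBot ℝ)) ≤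
      ⊥ := by
    refine Finset.sup_le fun k hk => ?_
    have : k ≠ j := fun h => Finset.disjoint_left.1 hIJ hk (h ▸ hj)
    simp [this]
  have h3 := h1.trans h2
  simp only [if_true, zero_add, le_bot_iff] at h3
  exact WithBot.coe_ne_bot h3

/-- Tested on the vector equal to `b` at `i` and `j` and ⊥ elsewhere, which lies on the boundary of
the smaller half-space or inside it. -/
lemma le_of_halfSpace_subset {a b : Fin n → ℝ} {I J I' J' : Finset (Fin n)}
    (hIJ : Disjoint I J) (h : halfSpace b I' J' ⊆ halfSpace a I J) {i j : Fin n} (hi : i ∈ I')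
    (hj : j ∈ J) : i ∈ I ∧ b j - a j ≤ b i - a i := by
  classical
  set x : Fin n → WithBot ℝ := fun k => if k = i ∨ k = j then (b k : WithBot ℝ) else ⊥ with hx
  have hmem : x ∈ halfSpace b I' J' := by
    simp only [halfSpace, Set.mem_ofPred_eq]
    refine le_trans (b := (0 : WithBot ℝ)) (Finset.sup_le fun k _ => ?_) ?_
    · by_cases hk : k = i ∨ k = j
      · simp only [hx, if_pos hk, ← WithBot.coe_add]
        simp
      · simp [hx, if_neg hk]
    · refine le_trans ?_ (Finset.le_sup hi)
      simp only [hx, true_or, if_true, ← WithBot.coe_add]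
      simp
  have hmem' := h hmem
  simp only [halfSpace, Set.mem_ofPred_eq] at hmem'
  have h1 := (Finset.le_sup (f := fun k => x k + ((-a k : ℝ) : WithBot ℝ)) hj).trans hmem'
  simp only [hx, or_true, if_true, ← WithBot.coe_add] at h1
  rw [Finset.le_sup_iff (WithBot.bot_lt_coe _)] at h1
  obtain ⟨m, hm, hle⟩ := h1
  have hmj : m ≠ j := fun h => Finset.disjoint_left.1 hIJ hm (h ▸ hj)
  by_cases hmi : m = i
  · subst hmi
    simp only [true_or, if_true, ← WithBot.coe_add, WithBot.coe_le_coe] at hle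
    exact ⟨hm, by linarith⟩
  · simp [hmi, hmj] at hle

lemma HasApex.unique {H : Set (Fin n → WithBot ℝ)} {α β : ProjSpace n} (hα : HasApex H α)
    (hβ : HasApex H β) : α = β := by
  obtain ⟨a, I, hI, hIu, rfl, rfl⟩ := hα
  obtain ⟨b, I', hI', hIu', rfl, hab⟩ := hβ
  obtain ⟨i₀, hi₀⟩ := hI
  have hI : I = I' := by
    apply compl_injective
    exact (subset_of_halfSpace_subset disjoint_compl_right hab.ge).antisymm
      (subset_of_halfSpace_subset disjoint_compl_right hab.le)
  subst hI
  obtain ⟨j₀, hj₀⟩ : ∃ j, j ∉ I := by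
    by_contra hno
    push Not at hno
    exact hIu (Finset.eq_univ_iff_forall.2 hno)
  have key : ∀ i ∈ I, ∀ j ∉ I, a j - b j = a i - b i := by
    intro i hi j hj
    have h1 := (le_of_halfSpace_subset disjoint_compl_right hab.le hi
      (Finset.mem_compl.2 hj)).2
    have h2 := (le_of_halfSpace_subset disjoint_compl_right hab.ge hi
      (Finset.mem_compl.2 hj)).2
    linarith
  refine toProj_eq_iff.2 ⟨a i₀ - b i₀, fun k => ?_⟩
  by_cases hk : k ∈ I
  · linarith [key i₀ hi₀ j₀ hj₀, key k hk j₀ hj₀]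
  · linarith [key i₀ hi₀ k hk]

lemma mem_sigmaAt_of_mem_sigma {v : Fin p → Fin n → ℝ} {H : Set (Fin n → WithBot ℝ)}
    (hH : H ∈ sigma (generatedCone v)) {a : Fin n → ℝ} (ha : HasApex H (toProj a)) :
    InCone v a ∧ H ∈ sigmaAt (generatedCone v) (toProj a) := by
  obtain ⟨hCH, α, hα, hHα⟩ := hH
  rw [hHα.unique ha] at hα
  exact ⟨toProj_mem_projImage.1 hα, hCH, ha⟩

/-- The smallest half-space with apex `a` containing the cone. -/
def coreSpace (v : Fin p → Fin n → ℝ) (a : Fin n → ℝ) : Set (Fin n → WithBot ℝ) :=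
  halfSpace a (core v a) (core v a)ᶜ

lemma coreSpace_congr {v : Fin p → Fin n → ℝ} {a b : Fin n → ℝ} (h : toProj a = toProj b) :
    coreSpace v a = coreSpace v b := by
  obtain ⟨c, hc⟩ := toProj_eq_iff.1 h
  rw [coreSpace, coreSpace, core_congr hc, halfSpace_congr hc]

lemma coreSpace_subset_of_mem_sigmaAt {v : Fin p → Fin n → ℝ} {a : Fin n → ℝ}
    {H : Set (Fin n → WithBot ℝ)} (hH : H ∈ sigmaAt (generatedCone v) (toProj a)) :
    coreSpace v a ⊆ H := by
  obtain ⟨I, -, -, rfl, hI⟩ := mem_sigmaAt.1 hH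
  exact halfSpace_mono a (core_subset hI) (Finset.compl_subset_compl.2 (core_subset hI))

/-! ### The non-redundant apices -/

section Apices

variable [Nonempty (Fin n)]

lemma IsRegular.ofReal_mem_coreSpace {v : Fin p → Fin n → ℝ} (hv : IsRegular v) {a y : Fin n → ℝ}
    (ha : InCone v a) : ofReal y ∈ coreSpace v a ↔ Meets (core v a) a y :=
  ofReal_mem_halfSpace_compl (hv.core_nonempty ha)

lemma IsRegular.coreSpace_mem_sigmaAt {v : Fin p → Fin n → ℝ} (hv : IsRegular v) {a : Fin n → ℝ}
    (ha : InCone v a) (hu : core v a ≠ Finset.univ) :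
    coreSpace v a ∈ sigmaAt (generatedCone v) (toProj a) :=
  mem_sigmaAt.2 ⟨_, hv.core_nonempty ha, hu, rfl, hv a ha⟩

lemma core_ne_univ {v : Fin p → Fin n → ℝ} {a y : Fin n → ℝ} (h : ¬ Meets (core v a) a y) :
    core v a ≠ Finset.univ := by
  intro hu
  obtain ⟨i, hi⟩ := argTop_nonempty y a
  exact h ⟨i, hu ▸ Finset.mem_univ i, hi⟩

/-- Only the least element of each Σ_b matters for the intersection. If a point outside the cone
survived, the separating apex of `exists_separating` would be a boundary point not in τ'(X). -/
lemma tauApex_eq_boundary_iff {v : Fin p → Fin n → ℝ} (hp : 0 < p) (h : IsPure (generatedCone v))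
    {X : Set (ProjSpace n)} (hX : X ⊆ boundary (generatedCone v)) :
    tauApex (generatedCone v) X = boundary (generatedCone v) ↔ Spans v X := by
  have hv := isRegular_of_isPure h
  constructor
  · intro hXe y hy
    by_contra hyC
    obtain ⟨a, ha, hay⟩ := exists_separating hp hyC
    have hu := core_ne_univ hay
    have hmem : toProj a ∈ tauApex (generatedCone v) X := by
      rw [hXe]
      exact (toProj_mem_boundary h).2 ⟨ha, hu⟩
    obtain ⟨-, hsub⟩ := hmem
    obtain ⟨-, hsub⟩ := hsub (hv.coreSpace_mem_sigmaAt ha hu)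
    refine hay ((hv.ofReal_mem_coreSpace ha).1 (hsub fun K hK => ?_))
    obtain ⟨β, hβ, hK⟩ := Set.mem_iUnion₂.1 hK
    obtain ⟨b, rfl⟩ := toProj_surjective β
    exact coreSpace_subset_of_mem_sigmaAt hK
      ((hv.ofReal_mem_coreSpace ((toProj_mem_boundary h).1 (hX hβ)).1).2 (hy b hβ))
  · intro hspan
    refine Set.Subset.antisymm (fun α hα => hα.1) fun α hα => ⟨hα, fun H hH => ?_⟩
    obtain ⟨a, rfl⟩ := toProj_surjective α
    have ha := (toProj_mem_boundary h).1 hα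
    obtain ⟨I, hI, hIu, rfl, hIv⟩ := mem_sigmaAt.1 hH
    refine ⟨⟨hH.1, toProj a, toProj_mem_projImage.2 ha.1, hH.2⟩, ?_⟩
    refine sInter_subset_halfSpace (c := v ⟨0, hp⟩) ?_ ?_ ?_
    · intro K hK
      obtain ⟨β, -, -, b, J, -, -, -, hK⟩ := Set.mem_iUnion₂.1 hK
      exact ⟨b, J, Jᶜ, hK⟩
    · intro t K hK
      obtain ⟨β, -, hK, -⟩ := Set.mem_iUnion₂.1 hK
      exact hK (ofReal_mem_generatedCone.2 ((inCone_generator v _).add_const fun _ => rfl))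
    · intro x hx
      refine hH.1 (ofReal_mem_generatedCone.2 (hspan x fun b hb => ?_))
      obtain ⟨hbv, hbu⟩ := (toProj_mem_boundary h).1 (hX hb)
      exact (hv.ofReal_mem_coreSpace hbv).1
        (hx _ (Set.mem_iUnion₂.2 ⟨_, hb, hv.coreSpace_mem_sigmaAt hbv hbu⟩))

lemma isNonRedundantApexSet_iff {v : Fin p → Fin n → ℝ} (hp : 0 < p)
    (h : IsPure (generatedCone v)) {A : Set (ProjSpace n)} :
    IsNonRedundantApexSet (generatedCone v) A ↔ A.Finite ∧ A ⊆ boundary (generatedCone v) ∧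
      Spans v A ∧ ∀ B ⊆ A, Spans v B → A ⊆ B := by
  constructor
  · rintro ⟨⟨hfin, hA, hspan⟩, hmin⟩
    refine ⟨hfin, hA, (tauApex_eq_boundary_iff hp h hA).1 hspan, fun B hB hBs => ?_⟩
    exact hmin ⟨hfin.subset hB, hB.trans hA,
      (tauApex_eq_boundary_iff hp h (hB.trans hA)).2 hBs⟩ hB
  · rintro ⟨hfin, hA, hspan, hmin⟩
    refine ⟨⟨hfin, hA, (tauApex_eq_boundary_iff hp h hA).2 hspan⟩, ?_⟩
    rintro B ⟨-, hB, hBs⟩ hBA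
    exact hmin B hBA ((tauApex_eq_boundary_iff hp h hB).1 hBs)

lemma exists_isNonRedundantApexSet {v : Fin p → Fin n → ℝ} (hp : 0 < p)
    (h : IsPure (generatedCone v)) : ∃ A, IsNonRedundantApexSet (generatedCone v) A := by
  set X : Set (ProjSpace n) :=
    {α | ∃ a, toProj a = α ∧ IsVertex v a} ∩ boundary (generatedCone v) with hX
  have hfin : X.Finite := (finite_vertices v).subset Set.inter_subset_left
  have hspan : Spans v X := by
    intro y hy
    by_contra hyC
    obtain ⟨a, ha, hay⟩ := exists_separating_vertex hp hyC
    exact hay (hy a ⟨⟨a, rfl, ha⟩, (toProj_mem_boundary h).2 ⟨ha.1, core_ne_univ hay⟩⟩)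
  obtain ⟨A, ⟨hAX, hA⟩, hmin⟩ := Set.Finite.exists_minimal (s := {B | B ⊆ X ∧ Spans v B})
    (hfin.finite_subsets.subset fun B hB => hB.1) ⟨X, subset_rfl, hspan⟩
  exact ⟨A, (isNonRedundantApexSet_iff hp h).2 ⟨hfin.subset hAX,
    hAX.trans Set.inter_subset_right, hA, fun B hB hBs => hmin ⟨hB.trans hAX, hBs⟩ hB⟩⟩

lemma IsNonRedundantApexSet.exists_witness {v : Fin p → Fin n → ℝ} (hp : 0 < p)
    (h : IsPure (generatedCone v)) {A : Set (ProjSpace n)}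
    (hA : IsNonRedundantApexSet (generatedCone v) A) {a : Fin n → ℝ} (ha : toProj a ∈ A) :
    ∃ y, (∀ b, toProj b ∈ A \ {toProj a} → Meets (core v b) b y) ∧ ¬ Meets (core v a) a y := by
  obtain ⟨-, -, hspan, hmin⟩ := (isNonRedundantApexSet_iff hp h).1 hA
  by_contra hno
  push Not at hno
  refine (hmin (A \ {toProj a}) Set.sdiff_subset (fun y hy => hspan y fun b hb => ?_) ha).2 rfl
  by_cases hba : toProj b = toProj a
  · exact meets_core_congr hba (hno y hy)
  · exact hy b ⟨hb, hba⟩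

/-- The exchange argument, with `P` cut out by the core half-spaces at the other apices of `A`. -/
lemma IsNonRedundantApexSet.subset {v : Fin p → Fin n → ℝ} (hp : 0 < p)
    (h : IsPure (generatedCone v)) {A B : Set (ProjSpace n)}
    (hA : IsNonRedundantApexSet (generatedCone v) A) (hB : B.Finite)
    (hB' : B ⊆ boundary (generatedCone v)) (hBs : Spans v B) : A ⊆ B := by
  have hv := isRegular_of_isPure h
  obtain ⟨-, hA', hspan, -⟩ := (isNonRedundantApexSet_iff hp h).1 hA
  intro α hα
  obtain ⟨a, rfl⟩ := toProj_surjective α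
  obtain ⟨ha, hu⟩ := (toProj_mem_boundary h).1 (hA' hα)
  obtain ⟨y, hy, hya⟩ := hA.exists_witness hp h hα
  refine toProj_mem_of_irredundant hv hB (fun b hb => ((toProj_mem_boundary h).1 (hB' hb)).1) hBs
    ha (fun x hx => hv.meets ha hx (hv.core_nonempty ha))
    (P := {x | ∀ b, toProj b ∈ A \ {toProj a} → Meets (core v b) b x}) ?_ ?_ ?_ ?_ hy hya
  · exact fun x hx y hy b hb => (hx b hb).sup (hy b hb)
  · exact fun x hx t b hb => (hx b hb).add_const t
  · intro x hx b hb
    have hbv := ((toProj_mem_boundary h).1 (hA' hb.1)).1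
    exact hv.meets hbv hx (hv.core_nonempty hbv)
  · intro x hx hxa
    refine hspan x fun b hb => ?_
    by_cases hba : toProj b = toProj a
    · exact meets_core_congr hba hxa
    · exact hx b ⟨hb, hba⟩

end Apices

/-! ### Minimality of the core half-spaces -/

lemma eventually_argTop_subset [Nonempty (Fin n)] (x a : Fin n → ℝ) (S : Set (Fin n)) :
    ∀ᶠ δ in 𝓝[>] (0 : ℝ), argTop x (bump a S δ) ⊆ argTop x a := by
  obtain ⟨k, hk⟩ := argTop_nonempty x a
  have hsmall := eventually_lt_gap x a hk
  filter_upwards [hsmall, self_mem_nhdsWithin] with δ hδ hpos i hi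
  replace hpos : 0 < δ := hpos
  have hle : ∀ j, a j ≤ bump a S δ j ∧ bump a S δ j ≤ a j + δ := by
    intro j
    by_cases hj : j ∈ S
    · rw [bump_of_mem hj]
      constructor <;> linarith
    · rw [bump_of_notMem hj]
      constructor <;> linarith
  by_contra hia
  linarith [hδ i hia, hi k, (hle i).1, (hle k).2]

/-- If every generator whose type meets the complement of the core also meets the core outside `S`,
raising `a` on the part `S` of its core gives a smaller half-space. -/
lemma exists_smaller_coreSpace [Nonempty (Fin n)] {v : Fin p → Fin n → ℝ} (hv : IsRegular v)
    {a : Fin n → ℝ} (ha : InCone v a) (hu : core v a ≠ Finset.univ) {S : Set (Fin n)}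
    (hS : S.Nonempty) (hSc : S ⊆ core v a)
    (hdom : ∀ r, ∀ j ∈ argTop (v r) a, j ∉ core v a → ∃ i ∈ argTop (v r) a, i ∈ core v a ∧ i ∉ S) :
    ∃ a', InCone v a' ∧ core v a' ⊆ core v a ∧ toProj a ≠ toProj a' ∧
      ∀ y, Meets (core v a') a' y → Meets (core v a) a y := by
  obtain ⟨δ, hsub, hδ⟩ := ((eventually_all.2 fun r => eventually_argTop_subset (v r) a S).and
    self_mem_nhdsWithin).exists
  replace hδ : 0 < δ := hδ
  have hkeep : ∀ r, ∀ i ∈ argTop (v r) a, i ∉ S → i ∈ argTop (v r) (bump a S δ) := by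
    intro r i hi hiS j
    rw [bump_of_notMem hiS]
    by_cases hj : j ∈ S
    · rw [bump_of_mem hj]
      linarith [hi j]
    · rw [bump_of_notMem hj]
      exact hi j
  have hcore : core v (bump a S δ) ⊆ core v a := by
    intro i hi
    obtain ⟨r, hr⟩ := mem_core.1 hi
    have hir : i ∈ argTop (v r) a := hsub r (by rw [hr]; rfl)
    by_contra hic
    obtain ⟨k, hk, hkc, hkS⟩ := hdom r i hir hic
    have := hkeep r k hk hkS
    rw [hr] at this
    exact hic (this ▸ hkc)
  obtain ⟨j₀, hj₀⟩ : ∃ j, j ∉ core v a := by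
    by_contra hno
    push Not at hno
    exact hu (Finset.eq_univ_iff_forall.2 hno)
  have hin : InCone v (bump a S δ) := by
    intro i
    by_cases hi : i ∈ S
    · obtain ⟨r, hr⟩ := mem_core.1 (hSc hi)
      refine ⟨r, ?_⟩
      rw [(argTop_nonempty (v r) (bump a S δ)).subset_singleton_iff.1 ((hsub r).trans hr.subset)]
      rfl
    · obtain ⟨r, hr⟩ := ha i
      exact ⟨r, hkeep r i hr hi⟩
  refine ⟨bump a S δ, hin, hcore, fun heq => ?_, ?_⟩
  · obtain ⟨c, hc⟩ := toProj_eq_iff.1 heq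
    obtain ⟨i, hi⟩ := hS
    have h1 := hc i
    have h2 := hc j₀
    rw [bump_of_mem hi] at h1
    rw [bump_of_notMem fun h => hj₀ (hSc h)] at h2
    linarith
  · rintro y ⟨i, hi, hiy⟩
    refine (meets_iff (hv.core_nonempty ha)).2 ⟨i, hcore hi, fun j hj => ?_⟩
    have h1 := hiy j
    rw [bump_of_notMem fun h => Finset.mem_compl.1 hj (hSc h)] at h1
    by_cases hiS : i ∈ S
    · rw [bump_of_mem hiS] at h1
      linarith
    · rwa [bump_of_notMem hiS] at h1

lemma isMinimalHalfSpace_coreSpace [Nonempty (Fin n)] {v : Fin p → Fin n → ℝ} (hp : 0 < p)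
    (h : IsPure (generatedCone v)) {A : Set (ProjSpace n)}
    (hA : IsNonRedundantApexSet (generatedCone v) A) {a : Fin n → ℝ} (haA : toProj a ∈ A) :
    IsMinimalHalfSpace (generatedCone v) (coreSpace v a) := by
  have hv := isRegular_of_isPure h
  obtain ⟨hfin, hA', hspan, -⟩ := (isNonRedundantApexSet_iff hp h).1 hA
  obtain ⟨ha, hu⟩ := (toProj_mem_boundary h).1 (hA' haA)
  obtain ⟨j₀, hj₀⟩ : ∃ j, j ∉ core v a := by
    by_contra hno
    push Not at hno
    exact hu (Finset.eq_univ_iff_forall.2 hno)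
  refine ⟨⟨⟨a, _, _, hv.core_nonempty ha, ⟨j₀, Finset.mem_compl.2 hj₀⟩, disjoint_compl_right, rfl⟩,
    (hv.coreSpace_mem_sigmaAt ha hu).1⟩, ?_⟩
  rintro K ⟨⟨b, I, J, hI, hJ, hIJ, rfl⟩, hCK⟩ hle
  have hJsub : (core v a)ᶜ ⊆ J := subset_of_halfSpace_subset disjoint_compl_right hle
  have hle' := fun i hi j hj => le_of_halfSpace_subset disjoint_compl_right hle (i := i) (j := j)
    hi hj
  have hIsub : I ⊆ core v a := fun i hi => (hle' i hi j₀ (Finset.mem_compl.2 hj₀)).1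
  obtain ⟨i₀, hi₀, hai₀⟩ := (ofReal_mem_halfSpace hI).1 (hCK (ofReal_mem_generatedCone.2 ha))
  have hout : ∀ j ∉ core v a, a j - b j = a i₀ - b i₀ := by
    intro j hj
    have h1 := (hle' i₀ hi₀ j (Finset.mem_compl.2 hj)).2
    have h2 := hai₀ j (hJsub (Finset.mem_compl.2 hj))
    linarith
  have hin : ∀ i ∈ I, a i - b i ≤ a i₀ - b i₀ := by
    intro i hi
    have h1 := (hle' i hi j₀ (Finset.mem_compl.2 hj₀)).2
    linarith [hout j₀ hj₀]
  -- The core indices at which `K` is not tight at `a`; if there are none, `K` is the core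
  -- half-space.
  set S : Set (Fin n) := {i | i ∈ core v a ∧ ¬ (i ∈ I ∧ a i - b i = a i₀ - b i₀)} with hS
  rcases S.eq_empty_or_nonempty with hSe | hSne
  · have hall : ∀ i ∈ core v a, i ∈ I ∧ a i - b i = a i₀ - b i₀ := by
      intro i hi
      by_contra hno
      have : i ∈ S := ⟨hi, hno⟩
      rw [hSe] at this
      exact this
    have hIe : I = core v a := hIsub.antisymm fun i hi => (hall i hi).1
    subst hIe
    have hJe : J = (core v a)ᶜ := by
      refine Finset.Subset.antisymm (fun j hj => ?_) hJsub
      exact Finset.mem_compl.2 fun hjc => Finset.disjoint_left.1 hIJ hjc hj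
    have hab : ∀ i, a i = b i + (a i₀ - b i₀) := by
      intro i
      by_cases hi : i ∈ core v a
      · linarith [(hall i hi).2]
      · linarith [hout i hi]
    rw [hJe, coreSpace, halfSpace_congr hab]
  · exfalso
    obtain ⟨a', ha', hcore, hne, hmeets⟩ := exists_smaller_coreSpace hv ha hu hSne
      (fun i hi => hi.1) (by
        intro r j hj hjc
        -- The point `a` raised on the type of `v r` is in the cone, hence in `K`. Since `j` is
        -- raised, the index of `I` dominating it must also be raised and be tight, so it is outside
        -- `S`.
        obtain ⟨ε, ⟨t, ht⟩, hε⟩ :=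
          ((eventually_sup_eq_bump (v r) a).and self_mem_nhdsWithin).exists
        replace hε : 0 < ε := hε
        have hmem := ha.sup_generator r t
        rw [ht] at hmem
        obtain ⟨i, hi, hle⟩ := (ofReal_mem_halfSpace hI).1
          (hCK (ofReal_mem_generatedCone.2 hmem))
        have h1 := hle j (hJsub (Finset.mem_compl.2 hjc))
        rw [bump_of_mem hj] at h1
        have h2 := hout j hjc
        have h3 := hin i hi
        by_cases hir : i ∈ argTop (v r) a
        · rw [bump_of_mem hir] at h1
          exact ⟨i, hir, hIsub hi, fun h => h.2 ⟨hi, by linarith⟩⟩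
        · rw [bump_of_notMem hir] at h1
          linarith)
    have hu' : core v a' ≠ Finset.univ := fun h => hj₀ (hcore (h ▸ Finset.mem_univ j₀))
    -- Trading `a` for `a'` still spans, yet every finite spanning set must contain `a`.
    have hsub := hA.subset hp h (B := insert (toProj a') (A \ {toProj a}))
      ((hfin.subset Set.sdiff_subset).insert _)
      (Set.insert_subset ((toProj_mem_boundary h).2 ⟨ha', hu'⟩) (Set.sdiff_subset.trans hA'))
      (by
        intro y hy
        refine hspan y fun c hc => ?_
        by_cases hca : toProj c = toProj a
        · exact meets_core_congr hca (hmeets y (hy a' (Set.mem_insert _ _)))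
        · exact hy c (Set.mem_insert_of_mem _ ⟨hc, hca⟩))
    rcases hsub haA with heq | hmem
    · exact hne heq
    · exact hmem.2 rfl

/-! ### Non-redundant representations -/

/-- The apices of the half-spaces of a family. -/
def apices (Γ : Set (Set (Fin n → WithBot ℝ))) : Set (ProjSpace n) :=
  {α | ∃ H ∈ Γ, HasApex H α}

lemma finite_apices {Γ : Set (Set (Fin n → WithBot ℝ))} (hΓ : Γ.Finite) : (apices Γ).Finite := by
  have : apices Γ = ⋃ H ∈ Γ, {α | HasApex H α} := by
    ext α
    simp [apices]
  rw [this]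
  refine hΓ.biUnion fun H _ => Set.Subsingleton.finite fun α hα β hβ => ?_
  exact HasApex.unique hα hβ

lemma exists_rep_of_mem_sigma {v : Fin p → Fin n → ℝ} {H : Set (Fin n → WithBot ℝ)}
    (hH : H ∈ sigma (generatedCone v)) : ∃ (a : Fin n → ℝ) (I : Finset (Fin n)), I.Nonempty ∧
      I ≠ Finset.univ ∧ H = halfSpace a I Iᶜ ∧ InCone v a ∧ ∀ r, Meets I a (v r) := by
  obtain ⟨-, α, -, hα⟩ := id hH
  obtain ⟨a, rfl⟩ := toProj_surjective α
  obtain ⟨ha, hH'⟩ := mem_sigmaAt_of_mem_sigma hH hα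
  obtain ⟨I, hI, hIu, rfl, hIv⟩ := mem_sigmaAt.1 hH'
  exact ⟨a, I, hI, hIu, rfl, ha, hIv⟩

section Representation

variable {v : Fin p → Fin n → ℝ} {Γ : Set (Set (Fin n → WithBot ℝ))}

lemma IsNonRedundantRep.inCone (hΓ : IsNonRedundantRep (generatedCone v) Γ) {x : Fin n → ℝ}
    (hx : ∀ K ∈ Γ, ofReal x ∈ K) : InCone v x := by
  obtain ⟨-, -, he, -⟩ := hΓ
  rw [← ofReal_mem_generatedCone, he]
  exact hx

lemma IsNonRedundantRep.exists_witness (hp : 0 < p) (hΓ : IsNonRedundantRep (generatedCone v) Γ)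
    {H : Set (Fin n → WithBot ℝ)} (hH : H ∈ Γ) :
    ∃ y : Fin n → ℝ, (∀ K ∈ Γ \ {H}, ofReal y ∈ K) ∧ ofReal y ∉ H := by
  obtain ⟨-, hsub, -, hred⟩ := hΓ
  obtain ⟨a, I, -, -, rfl, -, -⟩ := exists_rep_of_mem_sigma (hsub hH)
  by_contra hno
  push Not at hno
  refine hred _ hH ⟨hsub hH, sInter_subset_halfSpace (c := v ⟨0, hp⟩) ?_ ?_ hno⟩
  · intro K hK
    obtain ⟨b, J, -, -, hK, -⟩ := exists_rep_of_mem_sigma (hsub hK.1)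
    exact ⟨b, J, Jᶜ, hK⟩
  · intro t K hK
    obtain ⟨hKC, -⟩ := hsub hK.1
    exact hKC (ofReal_mem_generatedCone.2 ((inCone_generator v _).add_const fun _ => rfl))

lemma ofReal_sup_mem_of_mem_sigma {K : Set (Fin n → WithBot ℝ)}
    (hK : K ∈ sigma (generatedCone v)) {x y : Fin n → ℝ} (hx : ofReal x ∈ K)
    (hy : ofReal y ∈ K) : ofReal (x ⊔ y) ∈ K := by
  obtain ⟨b, J, hJ, -, rfl, -⟩ := exists_rep_of_mem_sigma hK
  rw [ofReal_mem_halfSpace_compl hJ] at *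
  exact hx.sup hy

lemma ofReal_add_const_mem_of_mem_sigma {K : Set (Fin n → WithBot ℝ)}
    (hK : K ∈ sigma (generatedCone v)) {x : Fin n → ℝ} (hx : ofReal x ∈ K) (t : ℝ) :
    ofReal (fun i => x i + t) ∈ K := by
  obtain ⟨b, J, hJ, -, rfl, -⟩ := exists_rep_of_mem_sigma hK
  rw [ofReal_mem_halfSpace_compl hJ] at *
  exact hx.add_const t

variable [Nonempty (Fin n)]

/-- Each member of Γ is irredundant, so exchange puts its apex in `A`. Conversely the apices of Γ
span, since core half-spaces are smaller than the members of Γ. -/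
lemma IsNonRedundantRep.apices_eq (hp : 0 < p) (h : IsPure (generatedCone v))
    (hΓ : IsNonRedundantRep (generatedCone v) Γ) {A : Set (ProjSpace n)}
    (hA : IsNonRedundantApexSet (generatedCone v) A) : apices Γ = A := by
  have hv := isRegular_of_isPure h
  have hsub := hΓ.2.1
  obtain ⟨hfin, hA', hspan, -⟩ := (isNonRedundantApexSet_iff hp h).1 hA
  apply Set.Subset.antisymm
  · rintro α ⟨H, hH, hHα⟩
    obtain ⟨a, rfl⟩ := toProj_surjective α
    obtain ⟨ha, hH'⟩ := mem_sigmaAt_of_mem_sigma (hsub hH) hHα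
    obtain ⟨y, hy, hyH⟩ := hΓ.exists_witness hp hH
    obtain ⟨I, hI, -, rfl, hIv⟩ := mem_sigmaAt.1 hH'
    refine toProj_mem_of_irredundant hv hfin
      (fun b hb => ((toProj_mem_boundary h).1 (hA' hb)).1) hspan ha (fun x hx => hx.meets hI hIv)
      (P := {x | ∀ K ∈ Γ \ {halfSpace a I Iᶜ}, ofReal x ∈ K}) ?_ ?_ ?_ ?_ hy
      (fun hm => hyH ((ofReal_mem_halfSpace_compl hI).2 hm))
    · exact fun x hx y hy K hK => ofReal_sup_mem_of_mem_sigma (hsub hK.1) (hx K hK) (hy K hK)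
    · exact fun x hx t K hK => ofReal_add_const_mem_of_mem_sigma (hsub hK.1) (hx K hK) t
    · exact fun x hx K hK => (hsub hK.1).1 (ofReal_mem_generatedCone.2 hx)
    · intro x hx hxa
      refine hΓ.inCone fun K hK => ?_
      by_cases hKH : K = halfSpace a I Iᶜ
      · rw [hKH]
        exact (ofReal_mem_halfSpace_compl hI).2 hxa
      · exact hx K ⟨hK, hKH⟩
  · refine hA.subset hp h (finite_apices hΓ.1) ?_ ?_
    · rintro α ⟨H, hH, hHα⟩
      obtain ⟨a, rfl⟩ := toProj_surjective α
      obtain ⟨ha, hH'⟩ := mem_sigmaAt_of_mem_sigma (hsub hH) hHα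
      obtain ⟨I, hI, hIu, rfl, hIv⟩ := mem_sigmaAt.1 hH'
      refine (toProj_mem_boundary h).2 ⟨ha, fun hu => hIu ?_⟩
      exact Finset.univ_subset_iff.1 (hu ▸ core_subset hIv)
    · intro y hy
      refine hΓ.inCone fun K hK => ?_
      obtain ⟨-, α, -, hα⟩ := hsub hK
      obtain ⟨a, rfl⟩ := toProj_surjective α
      obtain ⟨ha, hK'⟩ := mem_sigmaAt_of_mem_sigma (hsub hK) hα
      exact coreSpace_subset_of_mem_sigmaAt hK'
        ((hv.ofReal_mem_coreSpace ha).2 (hy a ⟨K, hK, hα⟩))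

/-- Take `x` violating only `H` and `y` violating only `H'`. Their balanced join satisfies both, so
it is in the cone and is maximal at a core index; there `x` or `y` attains the maximum,
contradicting its violation. -/
lemma IsNonRedundantRep.eq_of_hasApex (hp : 0 < p) (h : IsPure (generatedCone v))
    (hΓ : IsNonRedundantRep (generatedCone v) Γ) {α : ProjSpace n}
    {H H' : Set (Fin n → WithBot ℝ)} (hH : H ∈ Γ) (hH' : H' ∈ Γ) (hα : HasApex H α)
    (hα' : HasApex H' α) : H = H' := by
  by_contra hne
  have hv := isRegular_of_isPure h
  have hsub := hΓ.2.1
  obtain ⟨a, rfl⟩ := toProj_surjective α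
  obtain ⟨ha, hHa⟩ := mem_sigmaAt_of_mem_sigma (hsub hH) hα
  obtain ⟨-, hHa'⟩ := mem_sigmaAt_of_mem_sigma (hsub hH') hα'
  obtain ⟨x, hx, hxH⟩ := hΓ.exists_witness hp hH
  obtain ⟨y, hy, hyH⟩ := hΓ.exists_witness hp hH'
  have hxH' := hx H' ⟨hH', fun he => hne he.symm⟩
  have hyH' := hy H ⟨hH, hne⟩
  obtain ⟨I, hI, -, hIe, hIv⟩ := mem_sigmaAt.1 hHa
  obtain ⟨I', hI', -, hIe', hIv'⟩ := mem_sigmaAt.1 hHa'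
  obtain ⟨k, hk⟩ := argTop_nonempty x a
  obtain ⟨l, hl⟩ := argTop_nonempty y a
  -- Equalizes the maxima of x - a and y + t - a, so that the join inherits the maximal sectors of
  -- both.
  set t := (x k - a k) - (y l - a l) with ht
  set w : Fin n → ℝ := x ⊔ fun i => y i + t with hw
  have hwx : ∀ i, x i ≤ w i := fun i => le_sup_left
  have hwy : ∀ i, y i + t ≤ w i := fun i => le_sup_right (a := x i)
  have hwle : ∀ i, w i - a i ≤ x k - a k := by
    intro i
    have : w i ≤ x k - a k + a i := sup_le (by linarith [hk i]) (by linarith [hl i])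
    linarith
  have hwC : InCone v w := by
    refine hΓ.inCone fun K hK => ?_
    by_cases hKH : K = H
    · rw [hKH, hIe, ofReal_mem_halfSpace_compl hI]
      rw [hIe, ofReal_mem_halfSpace_compl hI] at hyH'
      obtain ⟨i, hi, hiy⟩ := hyH'
      exact ⟨i, hi, fun j => by linarith [hwle j, hiy l, hwy i]⟩
    by_cases hKH' : K = H'
    · rw [hKH', hIe', ofReal_mem_halfSpace_compl hI']
      rw [hIe', ofReal_mem_halfSpace_compl hI'] at hxH'
      obtain ⟨i, hi, hix⟩ := hxH'
      exact ⟨i, hi, fun j => by linarith [hwle j, hix k, hwx i]⟩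
    exact ofReal_sup_mem_of_mem_sigma (hsub hK) (hx K ⟨hK, hKH⟩)
      (ofReal_add_const_mem_of_mem_sigma (hsub hK) (hy K ⟨hK, hKH'⟩) t)
  obtain ⟨i, hi, hiw⟩ := hv.meets ha hwC (hv.core_nonempty ha)
  rw [hIe, ofReal_mem_halfSpace_compl hI] at hxH
  rw [hIe', ofReal_mem_halfSpace_compl hI'] at hyH
  have hik := hiw k
  rcases le_total (x i) (y i + t) with hle | hle
  · have hwi : w i = y i + t := sup_of_le_right hle
    exact hyH ⟨i, core_subset hIv' hi, fun j => by linarith [hl j, hwx k]⟩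
  · have hwi : w i = x i := sup_of_le_left hle
    exact hxH ⟨i, core_subset hIv hi, fun j => by linarith [hk j, hwx k]⟩

end Representation

lemma hasApex_coreSpace [Nonempty (Fin n)] {v : Fin p → Fin n → ℝ} (h : IsPure (generatedCone v))
    {a : Fin n → ℝ} (ha : toProj a ∈ boundary (generatedCone v)) :
    coreSpace v a ∈ sigma (generatedCone v) ∧ HasApex (coreSpace v a) (toProj a) := by
  obtain ⟨ha, hu⟩ := (toProj_mem_boundary h).1 ha
  obtain ⟨h1, h2⟩ := (isRegular_of_isPure h).coreSpace_mem_sigmaAt ha hu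
  exact ⟨⟨h1, toProj a, toProj_mem_projImage.2 ha, h2⟩, h2⟩

/-- The smallest half-spaces at the non-redundant apices form a non-redundant representation. -/
lemma isNonRedundantRep_coreSpaces [Nonempty (Fin n)] {v : Fin p → Fin n → ℝ} (hp : 0 < p)
    (h : IsPure (generatedCone v)) {A : Set (ProjSpace n)}
    (hA : IsNonRedundantApexSet (generatedCone v) A) :
    IsNonRedundantRep (generatedCone v) {H | ∃ a, toProj a ∈ A ∧ H = coreSpace v a} := by
  have hv := isRegular_of_isPure h
  obtain ⟨hfin, hA', hspan, -⟩ := (isNonRedundantApexSet_iff hp h).1 hA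
  have hsub : {H | ∃ a, toProj a ∈ A ∧ H = coreSpace v a} ⊆ sigma (generatedCone v) := by
    rintro _ ⟨a, ha, rfl⟩
    exact (hasApex_coreSpace h (hA' ha)).1
  have hreal : ∀ b, toProj b ∈ A → ∀ y, ofReal y ∈ coreSpace v b → Meets (core v b) b y :=
    fun b hb y => (hv.ofReal_mem_coreSpace ((toProj_mem_boundary h).1 (hA' hb)).1).1
  refine ⟨?_, hsub, ?_, ?_⟩
  · choose s hs using toProj_surjective (n := n)
    refine (hfin.image fun α => coreSpace v (s α)).subset ?_
    rintro _ ⟨a, ha, rfl⟩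
    exact ⟨toProj a, ha, coreSpace_congr (hs _)⟩
  · refine Set.Subset.antisymm (Set.subset_sInter fun K hK => (hsub hK).1) ?_
    refine sInter_subset_generatedCone hp ?_ (fun K hK => (hsub hK).1) fun x hx => ?_
    · rintro _ ⟨a, -, rfl⟩
      exact ⟨a, _, _, rfl⟩
    · exact hspan x fun b hb => hreal b hb x (hx _ ⟨b, hb, rfl⟩)
  · rintro _ ⟨a, ha, rfl⟩ ⟨-, hred⟩
    obtain ⟨y, hy, hya⟩ := hA.exists_witness hp h ha
    refine hya (hreal a ha y (hred ?_))
    rintro _ ⟨⟨b, hb, rfl⟩, hne⟩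
    exact (hv.ofReal_mem_coreSpace ((toProj_mem_boundary h).1 (hA' hb)).1).2
      (hy b ⟨hb, fun hba => hne (coreSpace_congr hba)⟩)

end TropicalCone

/-! ### Assembly -/

theorem mainTheorem10 {n : ℕ} (C : Set (Fin n → WithBot ℝ))
    (hC : TropicalCone.IsRealPolyhedralCone C) (hpure : TropicalCone.IsPure C) :
    (∃! A : Set (TropicalCone.ProjSpace n), TropicalCone.IsNonRedundantApexSet C A) ∧
    (∀ A : Set (TropicalCone.ProjSpace n), TropicalCone.IsNonRedundantApexSet C A →
      ∀ Γ : Set (Set (Fin n → WithBot ℝ)), TropicalCone.IsNonRedundantRep C Γ →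
        (∀ H ∈ Γ, ∃ a ∈ A, TropicalCone.HasApex H a) ∧
        (∀ a ∈ A, ∃! H : Set (Fin n → WithBot ℝ), H ∈ Γ ∧ TropicalCone.HasApex H a)) ∧
    (∃! Γ : Set (Set (Fin n → WithBot ℝ)), TropicalCone.IsNonRedundantRep C Γ ∧
      ∀ H ∈ Γ, TropicalCone.IsMinimalHalfSpace C H) := by
  open TropicalCone in
  obtain ⟨p, v, hp, rfl⟩ := hC
  -- For `n = 0` there are no half-spaces and no boundary, and the cone is the whole one-point
  -- space, the empty intersection.
  rcases isEmpty_or_nonempty (Fin n) with hn | hn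
  · have hbd : boundary (generatedCone v) = ∅ := by
      refine Set.eq_empty_of_forall_notMem fun α hα => ?_
      obtain ⟨a, rfl⟩ := toProj_surjective α
      exact hα.2 (mem_interior_of_core_eq_univ (Finset.eq_univ_iff_forall.2 isEmptyElim))
    have hsig : sigma (generatedCone v) = ∅ := by
      refine Set.eq_empty_of_forall_notMem ?_
      rintro H ⟨-, α, -, b, I, ⟨i, -⟩, -⟩
      exact isEmptyElim i
    have hrep : ∀ Γ, IsNonRedundantRep (generatedCone v) Γ → Γ = ∅ := fun Γ hΓ =>
      Set.subset_empty_iff.1 (hsig ▸ hΓ.2.1)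
    have hapex : ∀ A, IsNonRedundantApexSet (generatedCone v) A → A = ∅ := fun A hA =>
      Set.subset_empty_iff.1 (hbd ▸ hA.1.2.1)
    refine ⟨⟨∅, ⟨⟨Set.finite_empty, Set.empty_subset _, ?_⟩, fun _ _ _ => Set.empty_subset _⟩,
      hapex⟩, ?_, ⟨∅, ⟨⟨Set.finite_empty, Set.empty_subset _, ?_, by simp⟩, by simp⟩,
      fun Γ hΓ => hrep Γ hΓ.1⟩⟩
    · exact Set.Subset.antisymm (fun α hα => hα.1) (hbd.le.trans (Set.empty_subset _))
    · intro A hA Γ hΓ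
      rw [hrep Γ hΓ, hapex A hA]
      simp
    · rw [Set.sInter_empty]
      exact Set.eq_univ_of_forall fun x => ⟨fun _ => ⊥, fun i => isEmptyElim i⟩
  obtain ⟨A, hA⟩ := exists_isNonRedundantApexSet hp hpure
  have hspec := fun B hB => (isNonRedundantApexSet_iff hp hpure (A := B)).1 hB
  obtain ⟨hfin, hA', hspan, -⟩ := hspec A hA
  have huniq : ∀ B, IsNonRedundantApexSet (generatedCone v) B → B = A := by
    intro B hB
    obtain ⟨hBfin, hB', hBspan, -⟩ := hspec B hB
    exact (hB.subset hp hpure hfin hA' hspan).antisymm (hA.subset hp hpure hBfin hB' hBspan)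
  refine ⟨⟨A, hA, huniq⟩, ?_, ?_⟩
  · intro B hB Γ hΓ
    rw [← hΓ.apices_eq hp hpure hB]
    refine ⟨fun H hH => ?_, ?_⟩
    · obtain ⟨-, α, -, hα⟩ := hΓ.2.1 hH
      exact ⟨α, ⟨H, hH, hα⟩, hα⟩
    · rintro α ⟨H, hH, hα⟩
      exact ⟨H, ⟨hH, hα⟩, fun K hK => hΓ.eq_of_hasApex hp hpure hK.1 hH hK.2 hα⟩
  · refine ⟨{H | ∃ a, toProj a ∈ A ∧ H = coreSpace v a},
      ⟨isNonRedundantRep_coreSpaces hp hpure hA, ?_⟩, ?_⟩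
    · rintro _ ⟨a, ha, rfl⟩
      exact isMinimalHalfSpace_coreSpace hp hpure hA ha
    · rintro Γ ⟨hΓ, hmin⟩
      have hap := hΓ.apices_eq hp hpure hA
      -- The core half-space lies inside any other one at the same apex, so minimality of `H` forces
      -- equality.
      have hcore : ∀ H ∈ Γ, ∀ a, HasApex H (toProj a) → H = coreSpace v a := by
        intro H hH a ha
        have haA : toProj a ∈ A := hap ▸ ⟨H, hH, ha⟩
        have hsub := coreSpace_subset_of_mem_sigmaAt (mem_sigmaAt_of_mem_sigma (hΓ.2.1 hH) ha).2
        exact ((hmin H hH).2 (isMinimalHalfSpace_coreSpace hp hpure hA haA).1 hsub).antisymm hsub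
      ext H
      constructor
      · intro hH
        obtain ⟨-, α, -, hα⟩ := hΓ.2.1 hH
        obtain ⟨a, rfl⟩ := toProj_surjective α
        exact ⟨a, hap ▸ ⟨H, hH, hα⟩, hcore H hH a hα⟩
      · rintro ⟨a, ha, rfl⟩
        rw [← hap] at ha
        obtain ⟨K, hK, hKa⟩ := ha
        rwa [← hcore K hK a hKa]
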